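/- Let $N\ge 1$, $0<s<1$, let $\Omega\subset\mathbb R^N$ be a bounded domain, and put $C_{N,s}=\frac{s2^{2s}\Gamma(\frac{2s+N}{2})}{\pi^{N/2}\Gamma(1-s)}$ and $$\mathcal F(u,w)=\frac{C_{N,s}}2\int_{\mathbb R^N}\int_{\mathbb R^N}\frac{(u(x)-u(y))(w(x)-w(y))}{|x-y|^{N+2s}}\,dx\,dy .$$ Let $\mathbb V=H_0^s(\Omega)=\{w\in H^s(\mathbb R^N): w=0 \text{ a.e. in }\mathbb R^N\setminus\Omega\}$ with the norm $\|w\|_{\mathbb V}=\mathcal F(w,w)^{1/2}$, let $\mathbb V^*=H^{-s}(\Omega)$ be its dual with respect to the pivot space $L^2(\Omega)$, and let $W(0,T;\mathbb V)=\{z\in L^2((0,T);\mathbb V): z_t\in L^2((0,T);\mathbb V^*)\}$ with the norm $\|z\|_{W(0,T;\mathbb V)}^2=\|z\|_{L^2((0,T);\mathbb V)}^2+\|z_t\|_{L^2((0,T);\mathbb V^*)}^2$; elements of $W(0,T;\mathbb V)$ are identified with their representatives in $C([0,T];L^2(\Omega))$. **Theorem 3.2.** There is a constant $C=C(N,s,\Omega)>0$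 such that the following holds for every $T>0$, every open $\omega\subset\Omega$, with $\omega_T=\omega\times(0,T)$ and $Q=\Omega\times(0,T)$, and all $f\in L^2((0,T);\mathbb V^*)$, $v\in L^\infty(\omega_T)$ and $\rho^0\in L^2(\Omega)$. Let $r=\|v\|_\infty:=\|v\|_{L^\infty(\omega_T)}$. Then the system $$z_t+(-\Delta)^sz+rz=vz\chi_\omega+e^{-rt}f\ \text{ in } Q,\qquad z=0\ \text{ in }(\mathbb R^N\setminus\Omega)\times(0,T),\qquad z(\cdot,0)=\rho^0\ \text{ in }\Omega$$ has a unique weak solution, that is, there is exactly one $z\in L^2((0,T);\mathbb V)$ such that $$-\int_0^T\langle\phi_t,z\rangle_{\mathbb V^*,\mathbb V}\,dt+\int_0^T\mathcal F(z,\phi)\,dt+r\int_Qz\phi\,dx\,dt-\int_{\omega_T}vz\phi\,dx\,dt=\int_0^Te^{-rt}\langle f,\phi\rangle_{\mathbb V^*,\mathbb V}\,dt+\int_\Omega\rho^0\phi(\cdot,0)\,dx$$ for every $\phi\in W(0,T;\mathbb V)$ with $\phi(\cdot,T)=0$ a.e. in $\Omega$. This solution belongs to $W(0,T;\mathbb V)$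 and satisfies $$\sup_{\tau\in[0,T]}\|z(\cdot,\tau)\|_{L^2(\Omega)}^2\le\|f\|_{L^2((0,T);\mathbb V^*)}^2+\|\rho^0\|_{L^2(\Omega)}^2,$$ $$\|z\|_{L^2((0,T);\mathbb V)}^2\le\|f\|_{L^2((0,T);\mathbb V^*)}^2+\|\rho^0\|_{L^2(\Omega)}^2,$$ $$\|z\|_{W(0,T;\mathbb V)}\le(C\|v\|_\infty+3)\big(\|f\|_{L^2((0,T);\mathbb V^*)}+\|\rho^0\|_{L^2(\Omega)}\big).$$ -/

import Mathlib

open MeasureTheory Set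
open scoped ENNReal

noncomputable section

/-- The Euclidean space `ℝ^N`. -/
abbrev Euc (N : ℕ) : Type := EuclideanSpace ℝ (Fin N)

/-- The normalization constant `C_{N,s} = s 2^{2s} Γ((2s+N)/2) / (π^{N/2} Γ(1-s))` of the
fractional Laplacian. -/
def fracConst (N : ℕ) (s : ℝ) : ℝ :=
  s * (2 : ℝ) ^ (2 * s) * Real.Gamma ((2 * s + N) / 2) /
    (Real.pi ^ ((N : ℝ) / 2) * Real.Gamma (1 - s))

theorem fracConst_pos (N : ℕ) (s : Ioo (0 : ℝ) 1) : 0 < fracConst N s := by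
  obtain ⟨s, h0, h1⟩ := s
  have hN : (0 : ℝ) ≤ N := N.cast_nonneg
  have g1 : 0 < Real.Gamma ((2 * s + N) / 2) := Real.Gamma_pos_of_pos (by linarith)
  have g2 : 0 < Real.Gamma (1 - s) := Real.Gamma_pos_of_pos (by linarith)
  have := Real.pi_pos
  unfold fracConst
  positivity

/-- The integrand `(u(x) - u(y)) (w(x) - w(y)) / |x - y|^{N+2s}`, as a function of `(x, y)`. -/
def fracIntegrand {N : ℕ} (s : ℝ) (u w : Euc N → ℝ) (p : Euc N × Euc N) : ℝ :=
  (u p.1 - u p.2) * (w p.1 - w p.2) / ‖p.1 - p.2‖ ^ ((N : ℝ) + 2 * s)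

/-- The bilinear form
`𝓕(u, w) = C_{N,s}/2 ∫∫ (u(x) - u(y)) (w(x) - w(y)) / |x - y|^{N+2s} dx dy`. -/
def fracForm {N : ℕ} (s : ℝ) (u w : Euc N → ℝ) : ℝ :=
  fracConst N s / 2 * ∫ p : Euc N × Euc N, fracIntegrand s u w p

section Facts

variable {N : ℕ} {s : ℝ}

theorem fracIntegrand_measurable {u w : Euc N → ℝ} (hu : Measurable u) (hw : Measurable w) :
    Measurable (fracIntegrand s u w) := by
  unfold fracIntegrand
  fun_prop

theorem fracIntegrand_self_nonneg (u : Euc N → ℝ) (p : Euc N × Euc N) :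
    0 ≤ fracIntegrand s u u p :=
  div_nonneg (mul_self_nonneg _) (Real.rpow_nonneg (norm_nonneg _) _)

theorem fracIntegrand_integrable {u w : Euc N → ℝ} (hu : Measurable u) (hw : Measurable w)
    (hu2 : Integrable (fracIntegrand s u u)) (hw2 : Integrable (fracIntegrand s w w)) :
    Integrable (fracIntegrand s u w) := by
  refine (hu2.add hw2).mono' (fracIntegrand_measurable hu hw).aestronglyMeasurable
    (Filter.Eventually.of_forall fun p => ?_)
  have hk : 0 ≤ ‖p.1 - p.2‖ ^ ((N : ℝ) + 2 * s) := Real.rpow_nonneg (norm_nonneg _) _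
  simp only [fracIntegrand, Pi.add_apply, Real.norm_eq_abs]
  rw [abs_div, abs_of_nonneg hk, ← add_div]
  refine div_le_div_of_nonneg_right ?_ hk
  rw [abs_le]
  constructor <;>
    nlinarith [sq_nonneg (u p.1 - u p.2 + (w p.1 - w p.2)),
      sq_nonneg (u p.1 - u p.2 - (w p.1 - w p.2)), mul_self_nonneg (u p.1 - u p.2),
      mul_self_nonneg (w p.1 - w p.2)]

theorem fracIntegrand_congr {u u' w w' : Euc N → ℝ} (hu : u =ᵐ[volume] u')
    (hw : w =ᵐ[volume] w') :
    fracIntegrand s u w =ᵐ[volume] fracIntegrand s u' w' := by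
  have h1 := Measure.quasiMeasurePreserving_fst (μ := (volume : Measure (Euc N)))
    (ν := (volume : Measure (Euc N)))
  have h2 := Measure.quasiMeasurePreserving_snd (μ := (volume : Measure (Euc N)))
    (ν := (volume : Measure (Euc N)))
  rw [Measure.volume_eq_prod]
  filter_upwards [h1.ae hu, h1.ae hw, h2.ae hu, h2.ae hw] with p a b c d
  simp only [fracIntegrand, a, b, c, d]

theorem fracIntegrand_add_left (u v w : Euc N → ℝ) :
    fracIntegrand s (u + v) w = fracIntegrand s u w + fracIntegrand s v w := by
  funext p
  simp only [fracIntegrand, Pi.add_apply]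
  ring

theorem fracIntegrand_comm (u w : Euc N → ℝ) : fracIntegrand s u w = fracIntegrand s w u := by
  funext p
  simp only [fracIntegrand]
  ring

theorem fracIntegrand_smul_left (c : ℝ) (u w : Euc N → ℝ) :
    fracIntegrand s (c • u) w = c • fracIntegrand s u w := by
  funext p
  simp only [fracIntegrand, Pi.smul_apply, smul_eq_mul]
  ring

theorem lp_measurable (u : Lp ℝ 2 (volume : Measure (Euc N))) : Measurable u :=
  (Lp.stronglyMeasurable u).measurable

end Facts

/-- `H₀ˢ(Ω)` as a set of functions: the `u ∈ L²(ℝ^N)` with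
`∫∫ |u(x) - u(y)|² / |x - y|^{N+2s} dx dy < ∞` (that is, `u ∈ Hˢ(ℝ^N)`) and `u = 0` almost
everywhere in `ℝ^N \ Ω`. -/
def hZeroSubmodule {N : ℕ} (s : ℝ) (Ω : Set (Euc N)) :
    Submodule ℝ (Lp ℝ 2 (volume : Measure (Euc N))) where
  carrier := {u | Integrable (fracIntegrand s u u) ∧
    ∀ᵐ x ∂(volume : Measure (Euc N)), x ∉ Ω → u x = 0}
  zero_mem' := by
    have h0 := Lp.coeFn_zero ℝ 2 (volume : Measure (Euc N))
    refine ⟨?_, ?_⟩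
    · refine Integrable.congr ?_ (fracIntegrand_congr h0.symm h0.symm)
      have : fracIntegrand (N := N) s 0 0 = 0 := by
        funext p
        simp [fracIntegrand]
      rw [this]
      exact integrable_zero _ _ _
    · filter_upwards [h0] with x hx _
      exact hx
  add_mem' := by
    rintro u w ⟨hu, hu0⟩ ⟨hw, hw0⟩
    have h := Lp.coeFn_add u w
    refine ⟨?_, ?_⟩
    · refine Integrable.congr ?_ (fracIntegrand_congr h.symm h.symm)
      have huw := fracIntegrand_integrable (lp_measurable u) (lp_measurable w) hu hw
      rw [fracIntegrand_add_left, fracIntegrand_comm (u : Euc N → ℝ),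
        fracIntegrand_comm (w : Euc N → ℝ), fracIntegrand_add_left, fracIntegrand_add_left,
        fracIntegrand_comm (w : Euc N → ℝ) (u : Euc N → ℝ)]
      exact (hu.add huw).add (huw.add hw)
    · filter_upwards [h, hu0, hw0] with x hx a b hxΩ
      rw [hx, Pi.add_apply, a hxΩ, b hxΩ, add_zero]
  smul_mem' := by
    rintro c u ⟨hu, hu0⟩
    have h := Lp.coeFn_smul c u
    refine ⟨?_, ?_⟩
    · refine Integrable.congr ?_ (fracIntegrand_congr h.symm h.symm)
      rw [fracIntegrand_smul_left, fracIntegrand_comm, fracIntegrand_smul_left]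
      exact (hu.smul c).smul c
    · filter_upwards [h, hu0] with x hx a hxΩ
      rw [hx, Pi.smul_apply, a hxΩ, smul_zero]

/-- The space `𝕍 = H₀ˢ(Ω)`. It is a type of its own, so that it does not inherit the norm
of `L²(ℝ^N)`: its norm is `‖u‖ = 𝓕(u, u)^{1/2}`, see `hZeroCore`. -/
def HZero {N : ℕ} (s : Ioo (0 : ℝ) 1) (Ω : Set (Euc N)) : Type :=
  hZeroSubmodule (s : ℝ) Ω

section HZeroStructure

variable {N : ℕ} {s : Ioo (0 : ℝ) 1} {Ω : Set (Euc N)}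

instance : AddCommGroup (HZero s Ω) := inferInstanceAs (AddCommGroup (hZeroSubmodule (s : ℝ) Ω))

instance : Module ℝ (HZero s Ω) := inferInstanceAs (Module ℝ (hZeroSubmodule (s : ℝ) Ω))

/-- The inclusion `H₀ˢ(Ω) ⊆ L²(ℝ^N)`. -/
def HZero.incl : HZero s Ω →ₗ[ℝ] Lp ℝ 2 (volume : Measure (Euc N)) :=
  (hZeroSubmodule (s : ℝ) Ω).subtype

/-- The function `ℝ^N → ℝ` underlying an element of `H₀ˢ(Ω)`. -/
def HZero.fn (u : HZero s Ω) : Euc N → ℝ := u.incl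

theorem HZero.integrable (u w : HZero s Ω) : Integrable (fracIntegrand (s : ℝ) u.fn w.fn) :=
  fracIntegrand_integrable (lp_measurable _) (lp_measurable _) u.2.1 w.2.1

theorem HZero.definite [NeZero N] (u : HZero s Ω)
    (h : fracForm (s : ℝ) u.fn u.fn = 0) : u = 0 := by
  have hC := fracConst_pos N s
  have hI : ∫ p : Euc N × Euc N, fracIntegrand (s : ℝ) u.fn u.fn p = 0 := by
    rcases mul_eq_zero.1 h with h | h
    · linarith
    · exact h
  rw [integral_eq_zero_iff_of_nonneg (fun p => fracIntegrand_self_nonneg _ p)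
    (u.integrable u)] at hI
  have hd : ∀ᵐ p ∂((volume : Measure (Euc N)).prod volume), u.fn p.1 = u.fn p.2 := by
    rw [Measure.volume_eq_prod] at hI
    filter_upwards [hI] with p hp
    by_cases hxy : p.1 = p.2
    · rw [hxy]
    · have hk : 0 < ‖p.1 - p.2‖ ^ ((N : ℝ) + 2 * (s : ℝ)) :=
        Real.rpow_pos_of_pos (norm_pos_iff.2 (sub_ne_zero.2 hxy)) _
      have h2 : (u.fn p.1 - u.fn p.2) * (u.fn p.1 - u.fn p.2) = 0 := by
        rcases div_eq_zero_iff.1 hp with h | h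
        · exact h
        · exact absurd h hk.ne'
      exact sub_eq_zero.1 (mul_self_eq_zero.1 h2)
  obtain ⟨x, hx⟩ := (Measure.ae_ae_of_ae_prod hd).exists
  have hm : MemLp (fun _ : Euc N => u.fn x) 2 volume := by
    refine (memLp_congr_ae ?_).1 (Lp.memLp u.incl)
    filter_upwards [hx] with y hy
    exact hy.symm
  have hinf : (volume : Measure (Euc N)) univ = ∞ := by
    have : Nontrivial (Euc N) := by
      apply Module.nontrivial_of_finrank_pos (R := ℝ)
      simpa using Nat.pos_of_ne_zero (NeZero.ne N)
    have : NoncompactSpace (Euc N) := NormedSpace.noncompactSpace ℝ (Euc N)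
    exact measure_univ_of_isAddLeftInvariant _
  have hc : u.fn x = 0 := by
    rcases (memLp_const_iff (by norm_num) (by norm_num)).1 hm with h | h
    · exact h
    · rw [hinf] at h
      exact absurd h (lt_irrefl _)
  apply Subtype.ext
  apply Lp.ext
  refine Filter.EventuallyEq.trans ?_ (Lp.coeFn_zero ℝ 2 volume).symm
  filter_upwards [hx] with y hy
  exact hy.symm.trans hc

/-- The inner product of `H₀ˢ(Ω)` is the form `𝓕`. -/
abbrev hZeroCore [NeZero N] : InnerProductSpace.Core ℝ (HZero s Ω) where
  inner u w := fracForm (s : ℝ) u.fn w.fn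
  conj_inner_symm u w := by
    simp only [fracForm, conj_trivial]
    rw [fracIntegrand_comm]
  re_inner_nonneg u := by
    have := fracConst_pos N s
    have h : 0 ≤ ∫ p : Euc N × Euc N, fracIntegrand (s : ℝ) u.fn u.fn p :=
      integral_nonneg fun p => fracIntegrand_self_nonneg u.fn p
    simp only [RCLike.re_to_real, fracForm]
    positivity
  add_left u v w := by
    have h : (u + v).fn =ᵐ[volume] u.fn + v.fn := Lp.coeFn_add u.incl v.incl
    have h' := fracIntegrand_congr (s := (s : ℝ)) h (Filter.EventuallyEq.refl _ w.fn)
    simp only [fracForm]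
    rw [integral_congr_ae h', fracIntegrand_add_left,
      integral_add' (u.integrable w) (v.integrable w), mul_add]
  smul_left u w c := by
    have h : (c • u).fn =ᵐ[volume] c • u.fn := Lp.coeFn_smul c u.incl
    have h' := fracIntegrand_congr (s := (s : ℝ)) h (Filter.EventuallyEq.refl _ w.fn)
    simp only [fracForm, conj_trivial]
    rw [integral_congr_ae h', fracIntegrand_smul_left]
    simp only [Pi.smul_apply, smul_eq_mul]
    rw [integral_const_mul]
    ring
  definite u h := u.definite h

instance [NeZero N] : NormedAddCommGroup (HZero s Ω) :=
  (hZeroCore (s := s) (Ω := Ω)).toNormedAddCommGroup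

instance [NeZero N] : InnerProductSpace ℝ (HZero s Ω) :=
  InnerProductSpace.ofCore (hZeroCore (s := s) (Ω := Ω)).toCore

theorem HZero.inner_eq [NeZero N] (u w : HZero s Ω) :
    inner ℝ u w = fracForm (s : ℝ) u.fn w.fn := rfl

/-- The embedding `H₀ˢ(Ω) → L²(Ω)`, `u ↦ u|_Ω`. -/
def HZero.toL2 (u : HZero s Ω) : Lp ℝ 2 (volume.restrict Ω) :=
  ((Lp.memLp u.incl).restrict Ω).toLp u.fn

end HZeroStructure

section Evolution

variable {N : ℕ} [NeZero N]

/-- Lebesgue measure on `(0, T)`. -/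
abbrev timeMeasure (T : ℝ) : Measure ℝ := volume.restrict (Ioo 0 T)

/-- The dual space `𝕍* = H⁻ˢ(Ω)`, with the dual norm. -/
abbrev HDual (s : Ioo (0 : ℝ) 1) (Ω : Set (Euc N)) : Type := StrongDual ℝ (HZero s Ω)

/-- The Bochner space `L²((0, T); 𝕍)`. -/
abbrev L2V (s : Ioo (0 : ℝ) 1) (Ω : Set (Euc N)) (T : ℝ) : Type :=
  Lp (HZero s Ω) 2 (timeMeasure T)

/-- The Bochner space `L²((0, T); 𝕍*)`. -/
abbrev L2VDual (s : Ioo (0 : ℝ) 1) (Ω : Set (Euc N)) (T : ℝ) : Type :=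
  Lp (HDual s Ω) 2 (timeMeasure T)

/-- The space `L^∞(ω_T)` with `ω_T = ω × (0, T)`. -/
abbrev LInfCyl (ω : Set (Euc N)) (T : ℝ) : Type :=
  Lp ℝ ∞ ((volume : Measure (Euc N × ℝ)).restrict (ω ×ˢ Ioo 0 T))

variable {s : Ioo (0 : ℝ) 1} {Ω : Set (Euc N)} {T : ℝ}

/-- `g ∈ L²((0, T); 𝕍*)` is the derivative `z_t`, in the sense of `𝕍*`-valued distributions on
`(0, T)`, of `z ∈ L²((0, T); 𝕍)`; elements of `𝕍` are regarded as elements of `𝕍*` through the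
pivot space `L²(Ω)`, i.e. `⟨u, w⟩ = ∫_Ω u w dx`. Hence `z ∈ W(0, T; 𝕍)` if and only if
`IsTimeDeriv z g` for some `g`. -/
def IsTimeDeriv (z : L2V s Ω T) (g : L2VDual s Ω T) : Prop :=
  ∀ ψ : ℝ → ℝ, ContDiff ℝ (⊤ : ℕ∞) ψ → HasCompactSupport ψ → tsupport ψ ⊆ Ioo 0 T →
    ∀ w : HZero s Ω,
      ∫ t in Ioo 0 T, deriv ψ t * ∫ x in Ω, (z t).fn x * w.fn x =
        -∫ t in Ioo 0 T, ψ t * g t w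

/-- The norm of `z` in `W(0, T; 𝕍)`, where `g = z_t`. -/
def wNorm (z : L2V s Ω T) (g : L2VDual s Ω T) : ℝ := Real.sqrt (‖z‖ ^ 2 + ‖g‖ ^ 2)

/-- `y : [0, T] → L²(Ω)` is the continuous representative of `z`; its values are meant by
`z(·, t)` for single times `t ∈ [0, T]`. -/
def IsContRep (z : L2V s Ω T) (y : ℝ → Lp ℝ 2 (volume.restrict Ω)) : Prop :=
  ContinuousOn y (Icc 0 T) ∧ ∀ᵐ t ∂(timeMeasure T), y t = (z t).toL2

/-- Weak solutions `z ∈ L²((0, T); 𝕍)` of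
`z_t + (-Δ)ˢ z + r z = v z χ_ω + e^{-rt} f` in `Ω × (0, T)`, `z = 0` in `(ℝ^N \ Ω) × (0, T)`,
`z(·, 0) = ρ₀` in `Ω`. The test functions are the `φ ∈ W(0, T; 𝕍)` with `φ(·, T) = 0`; here
`φt` is `φ_t` and `φc` is the continuous representative of `φ`.

The integrals over `Ω × (0, T)` and `ω × (0, T)` are written as iterated ones because
`(z t).fn` is a representative of `z(·, t)` chosen for each `t` separately. -/
def IsWeakSolution (ω : Set (Euc N)) (r : ℝ) (f : L2VDual s Ω T) (v : LInfCyl ω T)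
    (ρ₀ : Lp ℝ 2 (volume.restrict Ω)) (z : L2V s Ω T) : Prop :=
  ∀ (φ : L2V s Ω T) (φt : L2VDual s Ω T) (φc : ℝ → Lp ℝ 2 (volume.restrict Ω)),
    IsTimeDeriv φ φt → IsContRep φ φc → φc T = 0 →
      -(∫ t in Ioo 0 T, φt t (z t))
          + (∫ t in Ioo 0 T, fracForm (s : ℝ) (z t).fn (φ t).fn)
          + r * (∫ t in Ioo 0 T, ∫ x in Ω, (z t).fn x * (φ t).fn x)
          - (∫ t in Ioo 0 T, ∫ x in ω, v (x, t) * (z t).fn x * (φ t).fn x)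
        = (∫ t in Ioo 0 T, Real.exp (-r * t) * f t (φ t))
          + ∫ x in Ω, ρ₀ x * φc 0 x

end Evolution

end

/-! Everything takes place in the triple `V → H → V*`, with functionals on `V` replaced by their
Riesz representatives and the embedding `j : V → H` kept explicit. Set `S = j† j`. An element `u` of
`V`, regarded as a functional through the pivot space, is represented by `S u`, so `z_t = G` means
that `S z` is a primitive of `G` in `V`.

The potential `q = r - v χ_ω` satisfies `0 ≤ q ≤ 2r` almost everywhere. Its form therefore induces a
nonnegative operator `B` on `L²(0, T; V)` with norm at most `2 r ‖j‖²`. The factor `e^{-rt}` is at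
most 1, so the right-hand side `F` satisfies `‖F‖ ≤ ‖f‖`. The problem becomes `z_t + z + B z = F`,
`z(0) = ρ`, with coercivity constant 1.

Existence follows from Lions' projection lemma. For test functions with `φ(T) = 0`, the adjoint
operator `K φ = φ + B† φ - φ_t` satisfies `⟪K φ, φ⟫ = ‖φ‖² + ⟪B φ, φ⟫ + ‖φ(0)‖² / 2`, and hence `‖K
φ‖` controls both `φ` and `φ(0)`.

Testing with `ψ(t) w` shows `z_t = F - z - B z`. The energy identity and Young's inequality then
give the bounds, and uniqueness follows by linearity (`IsWeakSol.estimates`, `IsWeakSol.eq`).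

The energy identity (`HasWeakDeriv.exists_isRep`) is obtained by regularization with `R n = (S +
1/(n+1))⁻¹`, which commutes with `S`. The function `j (R n (S z))` is the image of a primitive, so
integration by parts applies directly, and `S (R n) → 1` strongly because the injectivity of `j`
makes the range of `S` dense.

For `H₀ˢ(Ω)` two facts remain: the fractional Poincaré inequality, which provides `j`, and
completeness for the norm of the form. -/

open Filter
open scoped InnerProductSpace Topology

/-! ### Vector-valued integration by parts and the du Bois-Reymond lemma -/

section Calculus

variable {E F G : Type*} [NormedAddCommGroup E] [NormedSpace ℝ E] [NormedAddCommGroup F]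
  [NormedSpace ℝ F] [NormedAddCommGroup G] [NormedSpace ℝ G]

theorem integrable_bilin_prod (β : E →L[ℝ] F →L[ℝ] G) {μ ν : Measure ℝ} [SFinite μ] [SFinite ν]
    {a : ℝ → E} {b : ℝ → F} (ha : Integrable a μ) (hb : Integrable b ν) :
    Integrable (fun p : ℝ × ℝ => β (a p.1) (b p.2)) (μ.prod ν) := by
  refine ((ha.norm.mul_prod hb.norm).const_mul ‖β‖).mono' ?_ ?_
  · exact β.aestronglyMeasurable_comp₂ ha.aestronglyMeasurable.comp_fst
      hb.aestronglyMeasurable.comp_snd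
  · refine Filter.Eventually.of_forall fun p => ?_
    rw [← mul_assoc]
    exact β.le_opNorm₂ _ _

variable [CompleteSpace E] [CompleteSpace F] [CompleteSpace G]

/-- Integration by parts for primitives of integrable functions. -/
theorem integral_bilin_primitive (β : E →L[ℝ] F →L[ℝ] G) {s t : ℝ}
    {a : ℝ → E} {b : ℝ → F} (ha : IntegrableOn a (Ioo s t)) (hb : IntegrableOn b (Ioo s t)) :
    β (∫ τ in Ioo s t, a τ) (∫ τ in Ioo s t, b τ) =
      (∫ τ in Ioo s t, β (a τ) (∫ σ in Ioo s τ, b σ)) +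
        ∫ τ in Ioo s t, β (∫ σ in Ioo s τ, a σ) (b τ) := by
  set μ : Measure ℝ := volume.restrict (Ioo s t) with hμ
  have hI := integrable_bilin_prod β ha hb
  -- Fubini on the square, cut along the diagonal: the part `σ ≤ τ` gives the first integral, its
  -- complement the second.
  have hD : MeasurableSet {p : ℝ × ℝ | p.2 ≤ p.1} := measurableSet_le measurable_snd measurable_fst
  have hIc : ∀ τ ∈ Ioo s t, ∀ {H : Type _} [NormedAddCommGroup H] [NormedSpace ℝ H] (g : ℝ → H),
      ∫ σ, (Iic τ).indicator g σ ∂μ = ∫ σ in Ioo s τ, g σ := by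
    intro τ hτ H _ _ g
    rw [integral_indicator measurableSet_Iic, hμ, Measure.restrict_restrict measurableSet_Iic,
      ← integral_Ioc_eq_integral_Ioo]
    congr 2
    ext x
    simp only [mem_inter_iff, mem_Iic, mem_Ioo, mem_Ioc] at hτ ⊢
    constructor
    · rintro ⟨h1, h2, h3⟩; exact ⟨h2, h1⟩
    · rintro ⟨h1, h2⟩; exact ⟨h2, h1, by linarith⟩
  have hIo : ∀ τ ∈ Ioo s t, ∀ {H : Type _} [NormedAddCommGroup H] [NormedSpace ℝ H] (g : ℝ → H),
      ∫ σ, (Iio τ).indicator g σ ∂μ = ∫ σ in Ioo s τ, g σ := by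
    intro τ hτ H _ _ g
    rw [integral_indicator measurableSet_Iio, hμ, Measure.restrict_restrict measurableSet_Iio]
    congr 2
    ext x
    simp only [mem_inter_iff, mem_Iio, mem_Ioo] at hτ ⊢
    constructor
    · rintro ⟨h1, h2, h3⟩; exact ⟨h2, h1⟩
    · rintro ⟨h1, h2⟩; exact ⟨h2, h1, by linarith⟩
  have h1 : ∫ p, {p : ℝ × ℝ | p.2 ≤ p.1}.indicator (fun p => β (a p.1) (b p.2)) p ∂(μ.prod μ) =
      ∫ τ in Ioo s t, β (a τ) (∫ σ in Ioo s τ, b σ) := by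
    rw [integral_prod _ (hI.indicator hD)]
    refine setIntegral_congr_fun measurableSet_Ioo fun τ hτ => ?_
    rw [← hIc τ hτ, ← (β (a τ)).integral_comp_comm (hb.indicator measurableSet_Iic)]
    refine integral_congr_ae (Filter.Eventually.of_forall fun σ => ?_)
    by_cases h : σ ≤ τ <;> simp [indicator, h]
  have h2 : ∫ p, {p : ℝ × ℝ | p.2 ≤ p.1}ᶜ.indicator (fun p => β (a p.1) (b p.2)) p ∂(μ.prod μ) =
      ∫ τ in Ioo s t, β (∫ σ in Ioo s τ, a σ) (b τ) := by
    rw [integral_prod_symm _ (hI.indicator hD.compl)]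
    refine setIntegral_congr_fun measurableSet_Ioo fun τ hτ => ?_
    rw [← hIo τ hτ, ← ContinuousLinearMap.flip_apply,
      ← (β.flip (b τ)).integral_comp_comm (ha.indicator measurableSet_Iio)]
    refine integral_congr_ae (Filter.Eventually.of_forall fun σ => ?_)
    by_cases h : σ < τ <;> simp [indicator, h]
  have h3 : β (∫ τ in Ioo s t, a τ) (∫ τ in Ioo s t, b τ) =
      ∫ p, β (a p.1) (b p.2) ∂(μ.prod μ) := by
    rw [integral_prod _ hI, ← ContinuousLinearMap.flip_apply, ← (β.flip _).integral_comp_comm ha]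
    refine integral_congr_ae (Filter.Eventually.of_forall fun σ => ?_)
    simp only [ContinuousLinearMap.flip_apply]
    rw [← (β (a σ)).integral_comp_comm hb]
  rw [h3, ← h1, ← h2, integral_indicator hD, integral_indicator hD.compl,
    integral_add_compl hD hI]

theorem contDiff_primitive {θ : ℝ → ℝ} (hθ : ContDiff ℝ (⊤ : ℕ∞) θ) (a : ℝ) :
    ContDiff ℝ (⊤ : ℕ∞) (fun t => ∫ x in a..t, θ x) ∧ deriv (fun t => ∫ x in a..t, θ x) = θ := by
  have hd : ∀ t, HasDerivAt (fun t => ∫ x in a..t, θ x) (θ t) t := fun t =>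
    intervalIntegral.integral_hasDerivAt_right (hθ.continuous.intervalIntegrable _ _)
      (hθ.continuous.stronglyMeasurableAtFilter _ _) hθ.continuous.continuousAt
  have he : deriv (fun t => ∫ x in a..t, θ x) = θ := funext fun t => (hd t).deriv
  refine ⟨contDiff_infty_iff_deriv.2 ⟨fun t => (hd t).differentiableAt, ?_⟩, he⟩
  rw [he]
  exact hθ

/-- The primitive from 0 vanishes to the left of the support, and to the right of it because the
total integral is zero. It thus lives on the convex hull `[a, b]` of the support, which is compact
in `(0, T)`. -/
theorem exists_primitive_of_integral_eq_zero {T : ℝ} {θ : ℝ → ℝ}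
    (hθ : ContDiff ℝ (⊤ : ℕ∞) θ) (hc : HasCompactSupport θ) (hs : tsupport θ ⊆ Ioo 0 T)
    (h0 : ∫ x, θ x = 0) :
    ∃ ψ : ℝ → ℝ, ContDiff ℝ (⊤ : ℕ∞) ψ ∧ HasCompactSupport ψ ∧ tsupport ψ ⊆ Ioo 0 T ∧
      deriv ψ = θ := by
  obtain ⟨h1, h2⟩ := contDiff_primitive hθ 0
  rcases (tsupport θ).eq_empty_or_nonempty with he | hne
  · have : θ = 0 := tsupport_eq_empty_iff.1 he
    refine ⟨0, contDiff_const, HasCompactSupport.zero, ?_, ?_⟩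
    · simp
    · rw [this]; simp
  have ha := hs (hc.isCompact.sInf_mem hne)
  have hb := hs (hc.isCompact.sSup_mem hne)
  set a := sInf (tsupport θ)
  set b := sSup (tsupport θ)
  have hab : ∀ x, x ∉ Icc a b → θ x = 0 := by
    intro x hx
    by_contra h
    have hm : x ∈ tsupport θ := subset_tsupport _ h
    exact hx ⟨csInf_le hc.isCompact.bddBelow hm, le_csSup hc.isCompact.bddAbove hm⟩
  have hz : ∀ t, t ∉ Icc a b → ∫ x in (0:ℝ)..t, θ x = 0 := by
    intro t ht
    by_cases hta : t < a
    · refine (intervalIntegral.integral_congr (g := fun _ => (0 : ℝ)) fun x hx => ?_).trans (by simp)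
      refine hab x fun hx' => ?_
      have h3 : x ≤ max 0 t := hx.2
      exact absurd hx'.1 (not_le.2 (h3.trans_lt (max_lt ha.1 hta)))
    · have htb : b < t := by
        by_contra h
        exact ht ⟨not_lt.1 hta, not_lt.1 h⟩
      rw [← h0, intervalIntegral.integral_of_le (by linarith [hb.1])]
      refine setIntegral_eq_integral_of_forall_compl_eq_zero fun x hx => hab x fun hx' => hx ?_
      exact ⟨by linarith [hx'.1, ha.1], by linarith [hx'.2]⟩
  have hsub : tsupport (fun t => ∫ x in (0:ℝ)..t, θ x) ⊆ Icc a b := by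
    refine closure_minimal (fun t ht => ?_) isClosed_Icc
    by_contra h
    exact ht (hz t h)
  exact ⟨_, h1, HasCompactSupport.of_support_subset_isCompact isCompact_Icc
    ((subset_tsupport _).trans hsub),
    hsub.trans fun x hx => ⟨by linarith [hx.1, ha.1], by linarith [hx.2, hb.2]⟩, h2⟩

/-- The lemma of du Bois-Reymond. -/
theorem ae_eq_const_of_integral_deriv_smul_eq_zero {T : ℝ} (hT : 0 < T) {U : ℝ → E}
    (hU : IntegrableOn U (Ioo 0 T))
    (h : ∀ ψ : ℝ → ℝ, ContDiff ℝ (⊤ : ℕ∞) ψ → HasCompactSupport ψ → tsupport ψ ⊆ Ioo 0 T →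
      ∫ t in Ioo 0 T, deriv ψ t • U t = 0) :
    ∃ c : E, ∀ᵐ t ∂(timeMeasure T), U t = c := by
  have hint : ∀ η : ℝ → ℝ, Continuous η → HasCompactSupport η →
      IntegrableOn (fun t => η t • U t) (Ioo 0 T) := by
    intro η h1 h2
    obtain ⟨M, hM⟩ := h2.exists_bound_of_continuous h1
    exact hU.bdd_smul M h1.aestronglyMeasurable (Filter.Eventually.of_forall hM)
  -- A bump of mass one, supported in `[T/4, 3T/4]`; the constant is the average of `U` against it.
  let B : ContDiffBump (T / 2) := ⟨T / 8, T / 4, by positivity, by linarith⟩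
  set ψ₀ : ℝ → ℝ := B.normed volume with hψ₀
  have b1 : ContDiff ℝ (⊤ : ℕ∞) ψ₀ := B.contDiff_normed
  have b2 : HasCompactSupport ψ₀ := B.hasCompactSupport_normed
  have b3 : tsupport ψ₀ ⊆ Ioo 0 T := by
    rw [hψ₀, B.tsupport_normed_eq (μ := volume)]
    intro x hx
    rw [Real.closedBall_eq_Icc] at hx
    have h4 : B.rOut = T / 4 := rfl
    rw [h4] at hx
    exact ⟨by linarith [hx.1], by linarith [hx.2]⟩
  have b4 : ∫ x, ψ₀ x = 1 := B.integral_normed (μ := volume)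
  refine ⟨∫ t in Ioo 0 T, ψ₀ t • U t, ?_⟩
  set c := ∫ t in Ioo 0 T, ψ₀ t • U t
  have hUc : IntegrableOn (fun t => U t - c) (Ioo 0 T) :=
    hU.sub (integrableOn_const (μ := volume) (s := Ioo 0 T) (C := c) (by simp))
  have hmain := isOpen_Ioo.ae_eq_zero_of_integral_contDiff_smul_eq_zero (μ := volume)
    (U := Ioo 0 T) (f := fun t => U t - c)
    (hUc.locallyIntegrableOn) ?_
  · rw [ae_restrict_iff' measurableSet_Ioo]
    filter_upwards [hmain] with t ht h
    exact sub_eq_zero.1 (ht h)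
  intro η e1 e2 e3
  set m := ∫ x, η x
  -- Removing `m ψ₀` makes the mean of `η` zero, so the difference is the derivative of an
  -- admissible test function.
  obtain ⟨ψ, p1, p2, p3, p4⟩ := exists_primitive_of_integral_eq_zero (T := T)
    (θ := fun x => η x - m * ψ₀ x) (e1.sub (contDiff_const.mul b1))
    (e2.sub (b2.mul_left))
    ((tsupport_sub _ _).trans (union_subset e3 ((tsupport_mul_subset_right).trans b3)))
    (by
      rw [integral_sub (e1.continuous.integrable_of_hasCompactSupport e2)
        ((b1.continuous.integrable_of_hasCompactSupport b2).const_mul m), integral_const_mul, b4]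
      simp [m])
  have h5 := h ψ p1 p2 p3
  rw [p4] at h5
  have h6 : ∫ x, η x • (U x - c) = ∫ x in Ioo 0 T, η x • (U x - c) := by
    symm
    refine setIntegral_eq_integral_of_forall_compl_eq_zero fun x hx => ?_
    rw [image_eq_zero_of_notMem_tsupport fun hx' => hx (e3 hx'), zero_smul]
  have h7 : ∫ x in Ioo 0 T, η x = m := by
    refine setIntegral_eq_integral_of_forall_compl_eq_zero fun x hx => ?_
    rw [image_eq_zero_of_notMem_tsupport fun hx' => hx (e3 hx')]
  have hi := hint η e1.continuous e2
  rw [h6]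
  simp only [smul_sub]
  rw [integral_sub hi ((e1.continuous.integrable_of_hasCompactSupport e2).integrableOn.smul_const c),
    integral_smul_const, h7]
  simp only [sub_smul, mul_smul] at h5
  have hi' : IntegrableOn (fun t => m • ψ₀ t • U t) (Ioo 0 T) :=
    Integrable.smul m (hint ψ₀ b1.continuous b2)
  rw [integral_sub hi hi', integral_smul] at h5
  exact h5

/-- Integration by parts against a smooth function with compact support in `(0, T)`. -/
theorem integral_deriv_smul_primitive {T : ℝ} (hT : 0 < T) {a : ℝ → E}
    (ha : IntegrableOn a (Ioo 0 T)) {ψ : ℝ → ℝ} (h1 : ContDiff ℝ (⊤ : ℕ∞) ψ)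
    (h3 : tsupport ψ ⊆ Ioo 0 T) :
    ∫ t in Ioo 0 T, deriv ψ t • ∫ σ in Ioo 0 t, a σ = -∫ t in Ioo 0 T, ψ t • a t := by
  have hz : ∀ x, x ∉ Ioo 0 T → ψ x = 0 := fun x hx =>
    image_eq_zero_of_notMem_tsupport fun h => hx (h3 h)
  have hd : Continuous (deriv ψ) := h1.continuous_deriv (by simp)
  have hft : ∀ t, 0 ≤ t → ∫ x in Ioo 0 t, deriv ψ x = ψ t := by
    intro t ht
    rw [← integral_Ioc_eq_integral_Ioo, ← intervalIntegral.integral_of_le ht,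
      intervalIntegral.integral_deriv_eq_sub (fun x _ => (h1.differentiable (by simp)) x)
      (hd.intervalIntegrable _ _), hz 0 (by simp), sub_zero]
  have h := integral_bilin_primitive (ContinuousLinearMap.lsmul ℝ ℝ (E := E)) (s := 0) (t := T)
    (a := deriv ψ) (b := a) ((hd.integrableOn_Icc).mono_set Ioo_subset_Icc_self) ha
  rw [hft T hT.le, hz T (by simp)] at h
  simp only [ContinuousLinearMap.lsmul_apply, zero_smul] at h
  rw [eq_neg_iff_add_eq_zero, h]
  congr 1
  refine setIntegral_congr_fun measurableSet_Ioo fun t ht => ?_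
  rw [hft t ht.1.le]

end Calculus

/-! ### The Gram operator and its resolvents -/

section Resolvent

variable {V H : Type*} [NormedAddCommGroup V] [InnerProductSpace ℝ V]
  [NormedAddCommGroup H] [InnerProductSpace ℝ H]

variable (V) in
/-- The inner product of a real inner product space as a continuous bilinear map. -/
noncomputable def innerBilin : V →L[ℝ] V →L[ℝ] ℝ :=
  (innerₗ V).mkContinuous₂ 1 fun u w => by simpa using norm_inner_le_norm (𝕜 := ℝ) u w

theorem innerBilin_apply (u w : V) : innerBilin V u w = ⟪u, w⟫_ℝ := rfl

/-- Strong convergence to zero of uniformly bounded operators passes to `L²`. -/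
theorem tendsto_compLpL_of_tendsto {α : Type*} [MeasurableSpace α] {μ : Measure α}
    {A : ℕ → V →L[ℝ] V} {C : ℝ} (hb : ∀ n u, ‖A n u‖ ≤ C * ‖u‖)
    (hA : ∀ u, Tendsto (fun n => A n u) atTop (𝓝 0)) (z : Lp V 2 μ) :
    Tendsto (fun n => ‖(A n).compLpL 2 μ z‖) atTop (𝓝 0) := by
  have h1 : ∀ n, ‖(A n).compLpL 2 μ z‖ ^ 2 = ∫ t, ‖A n (z t)‖ ^ 2 ∂μ := fun n => by
    rw [← real_inner_self_eq_norm_sq, L2.inner_def]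
    refine integral_congr_ae ?_
    filter_upwards [(A n).coeFn_compLpL (p := 2) z] with t ht
    rw [real_inner_self_eq_norm_sq, ht]
  have h2 : Tendsto (fun n => ∫ t, ‖A n (z t)‖ ^ 2 ∂μ) atTop (𝓝 (∫ _, (0 : ℝ) ∂μ)) := by
    refine tendsto_integral_of_dominated_convergence (fun t => C ^ 2 * ‖z t‖ ^ 2)
      (fun n => ?_) ?_ (fun n => ?_) ?_
    · exact ((A n).continuous.comp_aestronglyMeasurable
        (Lp.aestronglyMeasurable z)).norm.pow 2
    · exact ((Lp.memLp z).integrable_norm_pow (by norm_num)).const_mul _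
    · refine Eventually.of_forall fun t => ?_
      rw [norm_pow, norm_norm, ← mul_pow]
      exact pow_le_pow_left₀ (norm_nonneg _) (hb n _) 2
    · refine Eventually.of_forall fun t => ?_
      simpa using ((hA (z t)).norm).pow 2
  simp only [integral_zero, ← h1] at h2
  have h3 := (Real.continuous_sqrt.tendsto 0).comp h2
  simpa [Function.comp_def, Real.sqrt_sq] using h3

variable [CompleteSpace V] [CompleteSpace H]

/-- The Gram operator `j† j` of `j : V → H`. -/
noncomputable def gramOp (j : V →L[ℝ] H) : V →L[ℝ] V := j.adjoint ∘L j

theorem inner_gramOp_left (j : V →L[ℝ] H) (u w : V) : ⟪gramOp j u, w⟫_ℝ = ⟪j u, j w⟫_ℝ := by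
  simp [gramOp, ContinuousLinearMap.adjoint_inner_left]

theorem inner_gramOp_right (j : V →L[ℝ] H) (u w : V) : ⟪u, gramOp j w⟫_ℝ = ⟪j u, j w⟫_ℝ := by
  simp [gramOp, ContinuousLinearMap.adjoint_inner_right]

theorem gramOp_add_smul_lower_bound (j : V →L[ℝ] H) (ε : ℝ) (u : V) :
    ε * ‖u‖ ≤ ‖gramOp j u + ε • u‖ := by
  rcases eq_or_ne u 0 with rfl | hu
  · simp
  have hu' : 0 < ‖u‖ := norm_pos_iff.2 hu
  have h1 : ε * ‖u‖ * ‖u‖ ≤ ⟪gramOp j u + ε • u, u⟫_ℝ := by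
    rw [inner_add_left, inner_gramOp_left, inner_smul_left, real_inner_self_eq_norm_sq,
      real_inner_self_eq_norm_sq]
    simp only [conj_trivial]
    nlinarith [sq_nonneg ‖j u‖]
  exact le_of_mul_le_mul_right (h1.trans (real_inner_le_norm _ _)) hu'

/-- `S + ε` is coercive because `S` is nonnegative, so Lax–Milgram inverts it; the inverse commutes
with `S` because `S + ε` does. -/
theorem exists_gramOp_resolvent (j : V →L[ℝ] H) {ε : ℝ} (hε : 0 < ε) :
    ∃ R : V →L[ℝ] V, (∀ u, gramOp j (R u) + ε • R u = u) ∧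
      (∀ u, R (gramOp j u) = gramOp j (R u)) ∧ ∀ u, ε * ‖R u‖ ≤ ‖u‖ := by
  let B : V →L[ℝ] V →L[ℝ] ℝ :=
    (innerBilin V).comp (gramOp j + ε • ContinuousLinearMap.id ℝ V)
  have hB : ∀ u w, B u w = ⟪gramOp j u + ε • u, w⟫_ℝ := fun u w => rfl
  have hc : IsCoercive B := by
    refine ⟨ε, hε, fun u => ?_⟩
    rw [hB, inner_add_left, inner_gramOp_left, inner_smul_left, real_inner_self_eq_norm_sq,
      real_inner_self_eq_norm_sq]
    simp only [conj_trivial]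
    nlinarith [sq_nonneg ‖j u‖]
  have he : ∀ u, hc.continuousLinearEquivOfBilin u = gramOp j u + ε • u := fun u =>
    ext_inner_right ℝ fun w => by rw [hc.continuousLinearEquivOfBilin_apply, hB]
  have hR : ∀ u, gramOp j (hc.continuousLinearEquivOfBilin.symm u) +
      ε • hc.continuousLinearEquivOfBilin.symm u = u := fun u => by
    rw [← he, ContinuousLinearEquiv.apply_symm_apply]
  refine ⟨hc.continuousLinearEquivOfBilin.symm, hR, fun u => ?_, fun u => ?_⟩
  · apply hc.continuousLinearEquivOfBilin.injective
    simp only [ContinuousLinearEquiv.coe_coe]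
    rw [ContinuousLinearEquiv.apply_symm_apply, he, ← map_smul, ← map_add, hR]
  · have := gramOp_add_smul_lower_bound j ε (hc.continuousLinearEquivOfBilin.symm u)
    rwa [hR] at this

/-- Operators `R n` commuting with the Gram operator `S` such that the `S (R n)` are uniformly
bounded and converge strongly to the identity. -/
theorem exists_gramOp_approx (j : V →L[ℝ] H) (hj : Function.Injective j) :
    ∃ R : ℕ → V →L[ℝ] V, (∀ n u, R n (gramOp j u) = gramOp j (R n u)) ∧
      (∀ n u, ‖gramOp j (R n u)‖ ≤ 2 * ‖u‖) ∧
      ∀ u, Tendsto (fun n => gramOp j (R n u)) atTop (𝓝 u) := by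
  have hpos : ∀ n : ℕ, (0 : ℝ) < 1 / ((n : ℝ) + 1) := fun n => Nat.one_div_pos_of_nat
  choose R h1 h2 h3 using fun n : ℕ => exists_gramOp_resolvent j (hpos n)
  have hSR : ∀ n u, gramOp j (R n u) = u - (1 / ((n : ℝ) + 1)) • R n u := fun n u =>
    eq_sub_of_add_eq (h1 n u)
  have hnorm : ∀ (n : ℕ) u, ‖(1 / ((n : ℝ) + 1)) • R n u‖ ≤ ‖u‖ := fun n u => by
    rw [norm_smul, Real.norm_of_nonneg (hpos n).le]
    exact h3 n u
  have hb : ∀ n u, ‖gramOp j (R n u)‖ ≤ 2 * ‖u‖ := fun n u => by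
    rw [hSR, two_mul]
    exact (norm_sub_le _ _).trans (by gcongr; exact hnorm n u)
  refine ⟨R, h2, hb, fun u => ?_⟩
  have hdense : Dense (range (gramOp j)) := by
    have : (gramOp j).range.topologicalClosure = ⊤ := by
      rw [Submodule.topologicalClosure_eq_top_iff, Submodule.eq_bot_iff]
      intro x hx
      -- A vector `x` orthogonal to the range satisfies `‖j x‖² = ⟪S x, x⟫ = 0`.
      have h := hx (gramOp j x) ⟨x, rfl⟩
      rw [inner_gramOp_left, inner_self_eq_zero] at h
      exact hj (h.trans (map_zero j).symm)
    exact Submodule.dense_iff_topologicalClosure_eq_top.2 this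
  rw [Metric.tendsto_atTop]
  intro δ hδ
  obtain ⟨_, ⟨w, rfl⟩, hw⟩ := Metric.mem_closure_iff.1 (hdense u) (δ / 2) (half_pos hδ)
  have ht : Tendsto (fun n : ℕ => 1 / ((n : ℝ) + 1) * (2 * ‖w‖)) atTop (𝓝 0) := by
    simpa using tendsto_one_div_add_atTop_nhds_zero_nat.mul_const (2 * ‖w‖)
  obtain ⟨n₀, hn₀⟩ := eventually_atTop.1 (ht.eventually_lt_const (half_pos hδ))
  refine ⟨n₀, fun n hn => ?_⟩
  -- With `ε = 1/(n+1)`, the error is `ε R u`. Splitting `u` as `(u - S w) + S w`, the first part is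
  -- small since `ε R` is a contraction, the second since `S R` is bounded and `ε → 0`.
  have h5 : u - gramOp j (R n u) = (1 / ((n : ℝ) + 1)) • R n (u - gramOp j w) +
      (1 / ((n : ℝ) + 1)) • gramOp j (R n w) := by
    rw [← h2 n w, ← smul_add, ← map_add, sub_add_cancel, hSR]
    abel
  rw [dist_comm, dist_eq_norm, h5]
  calc _ ≤ ‖u - gramOp j w‖ + 1 / ((n : ℝ) + 1) * (2 * ‖w‖) := by
        refine (norm_add_le _ _).trans (add_le_add (hnorm _ _) ?_)
        rw [norm_smul, Real.norm_of_nonneg (hpos n).le]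
        exact mul_le_mul_of_nonneg_left (hb n w) (hpos n).le
    _ < δ / 2 + δ / 2 := add_lt_add (by rwa [← dist_eq_norm]) (hn₀ n hn)
    _ = δ := add_halves δ

end Resolvent

/-! ### Primitives of integrable functions on an interval -/

section Primitive

variable {E : Type*} [NormedAddCommGroup E] [NormedSpace ℝ E] {T : ℝ} {a : ℝ → E}

theorem continuousOn_primitive_Ioo (ha : IntegrableOn a (Ioo 0 T)) :
    ContinuousOn (fun t => ∫ σ in Ioo 0 t, a σ) (Icc 0 T) := by
  have h := intervalIntegral.continuousOn_primitive (μ := volume) (a := 0) (b := T) (f := a)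
    ((integrableOn_Icc_iff_integrableOn_Ioo (by simp) (by simp)).2 ha)
  simpa only [integral_Ioc_eq_integral_Ioo] using h

theorem integral_Ioo_add_integral_Ioo (ha : IntegrableOn a (Ioo 0 T)) {s t : ℝ} (hs : 0 ≤ s)
    (hst : s ≤ t) (ht : t ≤ T) :
    (∫ σ in Ioo 0 s, a σ) + ∫ σ in Ioo s t, a σ = ∫ σ in Ioo 0 t, a σ := by
  have ha' : IntegrableOn a (Ioc 0 T) := (integrableOn_Ioc_iff_integrableOn_Ioo (by simp)).2 ha
  simp only [← integral_Ioc_eq_integral_Ioo]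
  rw [← Ioc_union_Ioc_eq_Ioc hs hst, setIntegral_union (Ioc_disjoint_Ioc_of_le le_rfl)
    measurableSet_Ioc (ha'.mono_set (Ioc_subset_Ioc_right (hst.trans ht)))
    (ha'.mono_set (Ioc_subset_Ioc hs ht))]

end Primitive

/-! ### Weak derivatives and the regularized energy identity -/

section LionsMagenes

theorem lp_two_integrable {E : Type*} [NormedAddCommGroup E] {T : ℝ}
    (z : Lp E 2 (timeMeasure T)) : IntegrableOn z (Ioo 0 T) :=
  (Lp.memLp z).integrable (by norm_num)

variable {V H : Type*} [NormedAddCommGroup V] [InnerProductSpace ℝ V]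
  [NormedAddCommGroup H] [InnerProductSpace ℝ H] {T : ℝ}

/-- `G` represents (by the inner product of `V`) the weak derivative of `z` with respect to the
pivot map `j`. -/
def HasWeakDeriv (j : V →L[ℝ] H) (z G : Lp V 2 (timeMeasure T)) : Prop :=
  ∀ ψ : ℝ → ℝ, ContDiff ℝ (⊤ : ℕ∞) ψ → HasCompactSupport ψ → tsupport ψ ⊆ Ioo 0 T →
    ∀ w : V, ∫ t in Ioo 0 T, deriv ψ t * ⟪j (z t), j w⟫_ℝ = -∫ t in Ioo 0 T, ψ t * ⟪G t, w⟫_ℝ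

/-- `y` is a continuous representative of `j z`. -/
def IsRep (j : V →L[ℝ] H) (z : Lp V 2 (timeMeasure T)) (y : ℝ → H) : Prop :=
  ContinuousOn y (Icc 0 T) ∧ ∀ᵐ t ∂(timeMeasure T), y t = j (z t)

theorem lp_two_norm_sq {α : Type*} [MeasurableSpace α] {μ : Measure α} (z : Lp V 2 μ) :
    ‖z‖ ^ 2 = ∫ t, ‖z t‖ ^ 2 ∂μ := by
  rw [← real_inner_self_eq_norm_sq, L2.inner_def]
  simp only [real_inner_self_eq_norm_sq]

theorem integral_norm_mul_norm_le {α E F : Type*} [MeasurableSpace α] {μ : Measure α}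
    [NormedAddCommGroup E] [NormedAddCommGroup F] (f : Lp E 2 μ) (g : Lp F 2 μ) :
    ∫ t, ‖f t‖ * ‖g t‖ ∂μ ≤ ‖f‖ * ‖g‖ := by
  have hf := (Lp.memLp f).norm
  have hg := (Lp.memLp g).norm
  have h := real_inner_le_norm (hf.toLp _) (hg.toLp _)
  rw [L2.inner_def, Lp.norm_toLp, Lp.norm_toLp, eLpNorm_norm, eLpNorm_norm] at h
  refine le_trans (le_of_eq (integral_congr_ae ?_)) h
  filter_upwards [hf.coeFn_toLp, hg.coeFn_toLp] with t h1 h2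
  rw [h1, h2, real_inner_eq_re_inner, RCLike.inner_apply]
  simp [mul_comm]

theorem IsRep.eqOn {j : V →L[ℝ] H} {z : Lp V 2 (timeMeasure T)} {y y' : ℝ → H} (hT : 0 < T)
    (h : IsRep j z y) (h' : IsRep j z y') : EqOn y y' (Icc 0 T) := by
  refine Measure.eqOn_Icc_of_ae_eq volume hT.ne ?_ h.1 h'.1
  rw [Measure.restrict_congr_set Ioo_ae_eq_Icc.symm]
  filter_upwards [h.2, h'.2] with t h1 h2
  rw [h1, h2]

variable [CompleteSpace V] [CompleteSpace H]

/-- Since `⟪j z, j w⟫ = ⟪S z, w⟫`, the weak derivative of `S z` in `V` is `G`, and du Bois-Reymond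
applies to `S z - ∫ G`. Nothing similar holds for `z` itself. -/
theorem HasWeakDeriv.exists_primitive {j : V →L[ℝ] H} {z G : Lp V 2 (timeMeasure T)} (hT : 0 < T)
    (h : HasWeakDeriv j z G) :
    ∃ c : V, ∀ᵐ t ∂(timeMeasure T), gramOp j (z t) = c + ∫ σ in Ioo 0 t, G σ := by
  have hG := lp_two_integrable G
  have hP : IntegrableOn (fun t => ∫ σ in Ioo 0 t, G σ) (Ioo 0 T) :=
    ((continuousOn_primitive_Ioo hG).integrableOn_Icc).mono_set Ioo_subset_Icc_self
  have hS : IntegrableOn (fun t => gramOp j (z t)) (Ioo 0 T) :=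
    (gramOp j).integrable_comp (lp_two_integrable z)
  suffices hmain : ∀ ψ : ℝ → ℝ, ContDiff ℝ (⊤ : ℕ∞) ψ → HasCompactSupport ψ →
      tsupport ψ ⊆ Ioo 0 T →
      ∫ t in Ioo 0 T, deriv ψ t • (gramOp j (z t) - ∫ σ in Ioo 0 t, G σ) = 0 by
    obtain ⟨c, hc⟩ := ae_eq_const_of_integral_deriv_smul_eq_zero hT (hS.sub hP) hmain
    refine ⟨c, ?_⟩
    filter_upwards [hc] with t ht
    rw [← ht, Pi.sub_apply, sub_add_cancel]
  intro ψ h1 h2 h3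
  have hbd : ∀ {η : ℝ → ℝ}, Continuous η → HasCompactSupport η → ∀ {U : ℝ → V},
      IntegrableOn U (Ioo 0 T) → IntegrableOn (fun t => η t • U t) (Ioo 0 T) := by
    intro η h1 h2 U hU
    obtain ⟨M, hM⟩ := h2.exists_bound_of_continuous h1
    exact hU.bdd_smul M h1.aestronglyMeasurable (Filter.Eventually.of_forall hM)
  have hd : Continuous (deriv ψ) := h1.continuous_deriv (by simp)
  have e1 := hbd hd h2.deriv hS
  have e2 := hbd hd h2.deriv hP
  have e3 := hbd h1.continuous h2 hG
  simp only [smul_sub]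
  rw [integral_sub e1 e2, integral_deriv_smul_primitive hT hG h1 h3, sub_neg_eq_add]
  refine ext_inner_left ℝ fun w => ?_
  have h5 := h ψ h1 h2 h3 w
  rw [inner_add_right, ← integral_inner e1, ← integral_inner e3, inner_zero_right,
    ← eq_neg_iff_add_eq_zero]
  refine Eq.trans ?_ (h5.trans ?_)
  · refine integral_congr_ae (Eventually.of_forall fun t => ?_)
    simp only [inner_smul_right]
    rw [inner_gramOp_right, real_inner_comm]
  · congr 1
    refine integral_congr_ae (Eventually.of_forall fun t => ?_)
    simp only [inner_smul_right]
    rw [real_inner_comm]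

/-- The energy identity after regularization by an operator commuting with the Gram operator. -/
theorem norm_sq_sub_norm_sq_of_commute {j : V →L[ℝ] H} {z G : Lp V 2 (timeMeasure T)} {c : V}
    (hc : ∀ᵐ t ∂(timeMeasure T), gramOp j (z t) = c + ∫ σ in Ioo 0 t, G σ)
    {A : V →L[ℝ] V} (hA : ∀ u, A (gramOp j u) = gramOp j (A u)) {s t : ℝ} (hs : 0 ≤ s)
    (hst : s ≤ t) (ht : t ≤ T) :
    ‖j (A (c + ∫ σ in Ioo 0 t, G σ))‖ ^ 2 - ‖j (A (c + ∫ σ in Ioo 0 s, G σ))‖ ^ 2 =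
      2 * ∫ τ in Ioo s t, ⟪gramOp j (A (G τ)), gramOp j (A (z τ))⟫_ℝ := by
  have hG := lp_two_integrable G
  have hsub : Ioo s t ⊆ Ioo 0 T := Ioo_subset_Ioo hs ht
  have hG' : IntegrableOn G (Ioo s t) := hG.mono_set hsub
  set Z : ℝ → V := fun t => c + ∫ σ in Ioo 0 t, G σ with hZ
  have hZsub : ∀ τ, s ≤ τ → τ ≤ T → Z τ = Z s + ∫ σ in Ioo s τ, G σ := fun τ h1 h2 => by
    simp only [hZ]
    rw [add_assoc, integral_Ioo_add_integral_Ioo hG hs h1 h2]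
  let β : V →L[ℝ] V →L[ℝ] ℝ := (innerBilin H).bilinearComp (j.comp A) (j.comp A)
  have hβ : ∀ u w, β u w = ⟪j (A u), j (A w)⟫_ℝ := fun u w => rfl
  have hsymm : ∀ u w, β u w = β w u := fun u w => by rw [hβ, hβ, real_inner_comm]
  have hq : ∀ u, ‖j (A u)‖ ^ 2 = β u u := fun u => by rw [hβ, real_inner_self_eq_norm_sq]
  have hcont : ContinuousOn (fun τ => ∫ σ in Ioo s τ, G σ) (Icc s t) := by
    refine (((continuousOn_primitive_Ioo hG).mono (Icc_subset_Icc hs ht)).sub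
      (continuousOn_const (c := ∫ σ in Ioo 0 s, G σ))).congr fun τ hτ => ?_
    simp only [Pi.sub_apply]
    rw [← integral_Ioo_add_integral_Ioo hG hs hτ.1 (hτ.2.trans ht), add_sub_cancel_left]
  -- By symmetry of `β` the two terms of the integration by parts coincide, which is the source of
  -- the factor 2.
  have hibp := integral_bilin_primitive β hG' hG'
  have hflip : ∫ τ in Ioo s t, β (∫ σ in Ioo s τ, G σ) (G τ) =
      ∫ τ in Ioo s t, β (G τ) (∫ σ in Ioo s τ, G σ) :=
    integral_congr_ae (Eventually.of_forall fun τ => hsymm _ _)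
  rw [hflip] at hibp
  have hi1 : IntegrableOn (fun τ => β (G τ) (Z s)) (Ioo s t) :=
    (β.flip (Z s)).integrable_comp hG'
  have hi2 : IntegrableOn (fun τ => β (G τ) (∫ σ in Ioo s τ, G σ)) (Ioo s t) := by
    obtain ⟨M, hM⟩ := isCompact_Icc.exists_bound_of_continuousOn hcont
    refine (hG'.norm.const_mul (‖β‖ * M)).mono' (β.aestronglyMeasurable_comp₂
      hG'.aestronglyMeasurable ((hcont.mono Ioo_subset_Icc_self).aestronglyMeasurable
        measurableSet_Ioo)) ?_
    rw [ae_restrict_iff' measurableSet_Ioo]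
    refine Eventually.of_forall fun τ hτ => ?_
    refine (β.le_opNorm₂ _ _).trans ?_
    rw [mul_right_comm]
    gcongr
    exact hM τ (Ioo_subset_Icc_self hτ)
  -- Almost everywhere `Z = S z`, and `A` commutes with `S`; hence `⟪j A G, j A Z⟫ = ⟪j A G, j S A
  -- z⟫ = ⟪S A G, S A z⟫`.
  have hpt : ∫ τ in Ioo s t, ⟪gramOp j (A (G τ)), gramOp j (A (z τ))⟫_ℝ =
      ∫ τ in Ioo s t, (β (G τ) (Z s) + β (G τ) (∫ σ in Ioo s τ, G σ)) := by
    refine integral_congr_ae ?_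
    filter_upwards [ae_restrict_of_ae_restrict_of_subset hsub hc,
      ae_restrict_mem measurableSet_Ioo] with τ h1 h2
    rw [← map_add, ← hZsub τ h2.1.le (h2.2.le.trans ht), hβ, hZ]
    simp only
    rw [← h1, hA, inner_gramOp_left]
  rw [hpt, integral_add hi1 hi2, hq, hq]
  have h1 : ∫ τ in Ioo s t, β (G τ) (Z s) = β (Z s) (∫ τ in Ioo s t, G τ) := by
    rw [hsymm]
    exact (β.flip (Z s)).integral_comp_comm hG'
  have h2 : c + ∫ σ in Ioo 0 t, G σ = Z s + ∫ σ in Ioo s t, G σ := hZsub t hst ht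
  have h3 : c + ∫ σ in Ioo 0 s, G σ = Z s := rfl
  rw [h1, h2, h3]
  simp only [map_add, add_apply]
  rw [hibp, hsymm (∫ τ in Ioo s t, G τ) (Z s)]
  ring

/-- The energy identity between `t` and an arbitrary `s`, averaged over `s` in `(0, T)`, which
produces the factor `1 / T`. Only the `L²` norms of `S A z` and `S A G` appear; for `A = R m - R n`
both are small, although `A` itself need not be. -/
theorem sup_norm_sq_le_of_commute {j : V →L[ℝ] H} {z G : Lp V 2 (timeMeasure T)} {c : V}
    (hT : 0 < T) (hc : ∀ᵐ t ∂(timeMeasure T), gramOp j (z t) = c + ∫ σ in Ioo 0 t, G σ)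
    {A : V →L[ℝ] V} (hA : ∀ u, A (gramOp j u) = gramOp j (A u)) {t : ℝ} (ht : t ∈ Icc 0 T) :
    ‖j (A (c + ∫ σ in Ioo 0 t, G σ))‖ ^ 2 ≤
      ‖j‖ ^ 2 / T * ‖((gramOp j).comp A).compLpL 2 (timeMeasure T) z‖ ^ 2 +
        2 * (‖((gramOp j).comp A).compLpL 2 (timeMeasure T) G‖ *
          ‖((gramOp j).comp A).compLpL 2 (timeMeasure T) z‖) := by
  set L := ((gramOp j).comp A).compLpL 2 (timeMeasure T) with hL
  have hLz := ((gramOp j).comp A).coeFn_compLpL (p := 2) z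
  have hLG := ((gramOp j).comp A).coeFn_compLpL (p := 2) G
  rw [← hL] at hLz hLG
  have hzint : IntegrableOn (fun τ => ‖L z τ‖ ^ 2) (Ioo 0 T) :=
    (Lp.memLp (L z)).integrable_norm_pow (by norm_num)
  have hzeq := (lp_two_norm_sq (L z)).symm
  have hprod : IntegrableOn (fun τ => ‖L G τ‖ * ‖L z τ‖) (Ioo 0 T) :=
    (Lp.memLp (L G)).norm.integrable_mul (Lp.memLp (L z)).norm
  have hprodle := integral_norm_mul_norm_le (L G) (L z)
  have hcross : ∀ s u, 0 ≤ s → s ≤ u → u ≤ T →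
      |∫ τ in Ioo s u, ⟪gramOp j (A (G τ)), gramOp j (A (z τ))⟫_ℝ| ≤ ‖L G‖ * ‖L z‖ := by
    intro s u hs _ hu
    have hsub : Ioo s u ⊆ Ioo 0 T := Ioo_subset_Ioo hs hu
    refine le_trans ?_ hprodle
    refine le_trans ?_ (setIntegral_mono_set hprod (Eventually.of_forall fun τ => by positivity)
      (Filter.Eventually.of_forall hsub))
    rw [← Real.norm_eq_abs]
    refine norm_integral_le_of_norm_le (hprod.mono_set hsub) ?_
    filter_upwards [ae_restrict_of_ae_restrict_of_subset hsub hLz,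
      ae_restrict_of_ae_restrict_of_subset hsub hLG] with τ h1 h2
    rw [h1, h2]
    exact norm_inner_le_norm _ _
  have hall : ∀ᵐ s ∂(timeMeasure T), ‖j (A (c + ∫ σ in Ioo 0 t, G σ))‖ ^ 2 ≤
      ‖j‖ ^ 2 * ‖L z s‖ ^ 2 + 2 * (‖L G‖ * ‖L z‖) := by
    filter_upwards [hc, hLz, ae_restrict_mem measurableSet_Ioo] with s h1 h2 h3
    have h4 : ‖j (A (c + ∫ σ in Ioo 0 s, G σ))‖ ^ 2 ≤ ‖j‖ ^ 2 * ‖L z s‖ ^ 2 := by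
      rw [← h1, h2, hA, ← mul_pow]
      exact pow_le_pow_left₀ (norm_nonneg _) (j.le_opNorm _) 2
    rcases le_total s t with hst | hst
    · have h5 := norm_sq_sub_norm_sq_of_commute hc hA h3.1.le hst ht.2
      have h6 := (abs_le.1 (hcross s t h3.1.le hst ht.2)).2
      linarith
    · have h5 := norm_sq_sub_norm_sq_of_commute hc hA ht.1 hst h3.2.le
      have h6 := (abs_le.1 (hcross t s ht.1 hst h3.2.le)).1
      linarith
  have hint := integral_mono_ae (integrable_const _) ((hzint.const_mul _).add
    (integrable_const _)) hall
  simp only [Pi.add_apply] at hint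
  rw [integral_add (hzint.const_mul _) (integrable_const _), integral_const_mul, hzeq] at hint
  simp only [integral_const, measureReal_restrict_apply_univ, Real.volume_real_Ioo_of_le hT.le,
    sub_zero, smul_eq_mul] at hint
  refine le_of_mul_le_mul_left (hint.trans_eq ?_) hT
  field_simp

end LionsMagenes

/-! ### Continuous representatives, the energy identity and integration by parts -/

section ContinuousRepresentative

variable {V H : Type*} [NormedAddCommGroup V] [InnerProductSpace ℝ V]
  [NormedAddCommGroup H] [InnerProductSpace ℝ H] {T : ℝ}

theorem IsRep.add {j : V →L[ℝ] H} {z₁ z₂ : Lp V 2 (timeMeasure T)} {y₁ y₂ : ℝ → H}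
    (h₁ : IsRep j z₁ y₁) (h₂ : IsRep j z₂ y₂) : IsRep j (z₁ + z₂) (y₁ + y₂) := by
  refine ⟨h₁.1.add h₂.1, ?_⟩
  filter_upwards [h₁.2, h₂.2, Lp.coeFn_add z₁ z₂] with t a b c
  rw [c, Pi.add_apply, Pi.add_apply, a, b, map_add]

theorem integrable_bounded_mul_inner {η : ℝ → ℝ} (h1 : Continuous η) (h2 : HasCompactSupport η)
    (x : Lp V 2 (timeMeasure T)) (w : V) :
    IntegrableOn (fun t => η t * ⟪x t, w⟫_ℝ) (Ioo 0 T) := by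
  obtain ⟨M, hM⟩ := h2.exists_bound_of_continuous h1
  exact ((lp_two_integrable x).inner_const w).bdd_mul h1.aestronglyMeasurable
    (Filter.Eventually.of_forall hM)

variable [CompleteSpace V] [CompleteSpace H]

/-- The theorem of Lions and Magenes: elements of `W(0, T; V)` are continuous with values in the
pivot space and satisfy the energy identity. -/
theorem HasWeakDeriv.exists_isRep {j : V →L[ℝ] H} (hj : Function.Injective j)
    {z G : Lp V 2 (timeMeasure T)} (hT : 0 < T) (h : HasWeakDeriv j z G) :
    ∃ y : ℝ → H, IsRep j z y ∧ (∀ t ∈ Icc 0 T, y t ∈ closure (range j)) ∧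
      ∀ s t, 0 ≤ s → s ≤ t → t ≤ T →
        ‖y t‖ ^ 2 - ‖y s‖ ^ 2 = 2 * ∫ τ in Ioo s t, ⟪G τ, z τ⟫_ℝ := by
  obtain ⟨c, hc⟩ := h.exists_primitive hT
  obtain ⟨R, hR1, hR2, hR3⟩ := exists_gramOp_approx j hj
  have hG := lp_two_integrable G
  set Z : ℝ → V := fun t => c + ∫ σ in Ioo 0 t, G σ with hZ
  have hZc : ContinuousOn Z (Icc 0 T) := continuousOn_const.add (continuousOn_primitive_Ioo hG)
  -- For almost every `t`, `Z t = S (z t)`, so `Y n t = j (S (R n (z t)))` tends to `j (z t)`.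
  set Y : ℕ → ℝ → H := fun n t => j (R n (Z t)) with hY
  have hYc : ∀ n, ContinuousOn (Y n) (Icc 0 T) := fun n =>
    (j.continuous.comp (R n).continuous).comp_continuousOn hZc
  set L : ℕ → Lp V 2 (timeMeasure T) → ℝ := fun n x =>
    ‖((gramOp j).comp (R n) - ContinuousLinearMap.id ℝ V).compLpL 2 (timeMeasure T) x‖ with hL
  have hLlim : ∀ x, Tendsto (fun n => L n x) atTop (𝓝 0) := by
    intro x
    refine tendsto_compLpL_of_tendsto (C := 3) (fun n u => ?_) (fun u => ?_) x
    · have h1 := norm_sub_le (gramOp j (R n u)) u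
      have h2 := hR2 n u
      simp only [sub_apply, ContinuousLinearMap.comp_apply, ContinuousLinearMap.id_apply]
      linarith
    · simpa using (hR3 u).sub_const u
  have hdiff : ∀ n m x, ‖((gramOp j).comp (R n - R m)).compLpL 2 (timeMeasure T) x‖ ≤
      L n x + L m x := by
    intro n m x
    have h1 : (gramOp j).comp (R n - R m) =
        ((gramOp j).comp (R n) - ContinuousLinearMap.id ℝ V) +
          (-1 : ℝ) • ((gramOp j).comp (R m) - ContinuousLinearMap.id ℝ V) := by
      ext u
      simp
    rw [h1, ContinuousLinearMap.add_compLpL, ContinuousLinearMap.smul_compLpL, add_apply,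
      smul_apply]
    refine (norm_add_le _ _).trans (le_of_eq ?_)
    rw [norm_smul]
    simp [hL]
  have hcauchy : UniformCauchySeqOn Y atTop (Icc 0 T) := by
    rw [Metric.uniformCauchySeqOn_iff]
    intro ε hε
    -- Both norms in the supremum bound will be below `2δ = ε / M`, which gives at most `M (ε / M)²
    -- = ε² / M < ε²`, since `M ≥ 2`.
    set M : ℝ := ‖j‖ ^ 2 / T + 2 with hM
    have hM2 : 2 ≤ M := by
      have : 0 ≤ ‖j‖ ^ 2 / T := by positivity
      linarith
    set δ := ε / (2 * M) with hδ
    have hδ0 : 0 < δ := by positivity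
    obtain ⟨n₀, hn₀⟩ := eventually_atTop.1 (((hLlim z).eventually_lt_const hδ0).and
      ((hLlim G).eventually_lt_const hδ0))
    refine ⟨n₀, fun m hm n hn t ht => ?_⟩
    have h1 := sup_norm_sq_le_of_commute hT hc (A := R m - R n)
      (fun u => by simp [hR1]) ht
    have hz := hdiff m n z
    have hg := hdiff m n G
    set a := ‖((gramOp j).comp (R m - R n)).compLpL 2 (timeMeasure T) z‖
    set b := ‖((gramOp j).comp (R m - R n)).compLpL 2 (timeMeasure T) G‖
    have ha0 : 0 ≤ a := norm_nonneg _
    have hb0 : 0 ≤ b := norm_nonneg _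
    have ha : a < 2 * δ := by linarith [(hn₀ m hm).1, (hn₀ n hn).1]
    have hb : b < 2 * δ := by linarith [(hn₀ m hm).2, (hn₀ n hn).2]
    have h2 : ‖j (( R m - R n) (Z t))‖ ^ 2 ≤ M * (2 * δ) ^ 2 := by
      refine h1.trans ?_
      have e1 : a ^ 2 ≤ (2 * δ) ^ 2 := pow_le_pow_left₀ ha0 ha.le 2
      have e2 : b * a ≤ (2 * δ) ^ 2 := by
        rw [pow_two]
        exact mul_le_mul hb.le ha.le ha0 (by positivity)
      have e3 : 0 ≤ ‖j‖ ^ 2 / T := by positivity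
      rw [hM, add_mul]
      exact add_le_add (mul_le_mul_of_nonneg_left e1 e3) (by linarith)
    have h3 : M * (2 * δ) ^ 2 < ε ^ 2 := by
      have h4 : 2 * δ = ε / M := by rw [hδ]; field_simp
      rw [h4, div_pow, pow_two M]
      have : M * (ε ^ 2 / (M * M)) = ε ^ 2 / M := by field_simp
      rw [this, div_lt_iff₀ (by linarith)]
      nlinarith [pow_pos hε 2]
    have h5 : dist (Y m t) (Y n t) = ‖j ((R m - R n) (Z t))‖ := by
      rw [dist_eq_norm, hY]
      simp
    rw [h5]
    exact lt_of_pow_lt_pow_left₀ 2 hε.le (h2.trans_lt h3)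
  have hlim : ∀ t ∈ Icc 0 T, Tendsto (fun n => Y n t) atTop (𝓝 (limUnder atTop fun n => Y n t)) :=
    fun t ht => (hcauchy.cauchySeq ht).tendsto_limUnder
  have hunif := hcauchy.tendstoUniformlyOn_of_tendsto hlim
  refine ⟨fun t => limUnder atTop fun n => Y n t, ⟨?_, ?_⟩, fun t ht => ?_, ?_⟩
  · exact hunif.continuousOn (Eventually.of_forall hYc).frequently
  · filter_upwards [hc, ae_restrict_mem measurableSet_Ioo] with t h1 h2
    refine tendsto_nhds_unique (hlim t (Ioo_subset_Icc_self h2)) ?_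
    have h3 : ∀ n, Y n t = j (gramOp j (R n (z t))) := fun n => by
      simp only [hY, hZ]
      rw [← h1, hR1]
    simp only [h3]
    exact (j.continuous.tendsto _).comp (hR3 (z t))
  · exact mem_closure_of_tendsto (hlim t ht) (Eventually.of_forall fun n => ⟨_, rfl⟩)
  · intro s t hs hst ht
    have h1 := fun n => norm_sq_sub_norm_sq_of_commute hc (A := R n) (hR1 n) hs hst ht
    have hsub : Ioo s t ⊆ Ioo 0 T := Ioo_subset_Ioo hs ht
    have h2 : Tendsto (fun n => ∫ τ in Ioo s t, ⟪gramOp j (R n (G τ)), gramOp j (R n (z τ))⟫_ℝ)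
        atTop (𝓝 (∫ τ in Ioo s t, ⟪G τ, z τ⟫_ℝ)) := by
      -- The factor 4 is the square of the uniform bound 2 on the operators `S (R n)`.
      refine tendsto_integral_of_dominated_convergence (fun τ => 4 * (‖G τ‖ * ‖z τ‖))
        (fun n => ?_) ?_ (fun n => ?_) ?_
      · have e : ∀ x : Lp V 2 (timeMeasure T), AEStronglyMeasurable
            (fun τ => gramOp j (R n (x τ))) (volume.restrict (Ioo s t)) := fun x =>
          (((gramOp j).comp (R n)).continuous.comp_aestronglyMeasurable
            (Lp.aestronglyMeasurable x)).mono_set hsub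
        exact (e G).inner (e z)
      · have : IntegrableOn (fun τ => ‖G τ‖ * ‖z τ‖) (Ioo 0 T) :=
          (Lp.memLp G).norm.integrable_mul (Lp.memLp z).norm
        exact (this.mono_set hsub).const_mul 4
      · refine Eventually.of_forall fun τ => (norm_inner_le_norm _ _).trans ?_
        have := mul_le_mul (hR2 n (G τ)) (hR2 n (z τ)) (norm_nonneg _) (by positivity)
        linarith
      · exact Eventually.of_forall fun τ => (hR3 _).inner (hR3 _)
    have h3 := ((hlim t ⟨hs.trans hst, ht⟩).norm.pow 2).sub
      ((hlim s ⟨hs, hst.trans ht⟩).norm.pow 2)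
    refine tendsto_nhds_unique h3 ((h2.const_mul 2).congr fun n => (h1 n).symm)

theorem HasWeakDeriv.add {j : V →L[ℝ] H} {z₁ z₂ G₁ G₂ : Lp V 2 (timeMeasure T)}
    (h₁ : HasWeakDeriv j z₁ G₁) (h₂ : HasWeakDeriv j z₂ G₂) :
    HasWeakDeriv j (z₁ + z₂) (G₁ + G₂) := by
  intro ψ p1 p2 p3 w
  have hd : Continuous (deriv ψ) := p1.continuous_deriv (by simp)
  have e1 : ∫ t in Ioo 0 T, deriv ψ t * ⟪j ((z₁ + z₂) t), j w⟫_ℝ =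
      ∫ t in Ioo 0 T, (deriv ψ t * ⟪z₁ t, gramOp j w⟫_ℝ + deriv ψ t * ⟪z₂ t, gramOp j w⟫_ℝ) := by
    refine integral_congr_ae ?_
    filter_upwards [Lp.coeFn_add z₁ z₂] with t ht
    rw [← inner_gramOp_right, ht, Pi.add_apply, inner_add_left, mul_add]
  have e2 : ∫ t in Ioo 0 T, ψ t * ⟪(G₁ + G₂) t, w⟫_ℝ =
      ∫ t in Ioo 0 T, (ψ t * ⟪G₁ t, w⟫_ℝ + ψ t * ⟪G₂ t, w⟫_ℝ) := by
    refine integral_congr_ae ?_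
    filter_upwards [Lp.coeFn_add G₁ G₂] with t ht
    rw [ht, Pi.add_apply, inner_add_left, mul_add]
  have a := h₁ ψ p1 p2 p3 w
  have b := h₂ ψ p1 p2 p3 w
  simp only [← inner_gramOp_right] at a b
  rw [e1, e2, integral_add (integrable_bounded_mul_inner hd p2.deriv _ _)
    (integrable_bounded_mul_inner hd p2.deriv _ _),
    integral_add (integrable_bounded_mul_inner p1.continuous p2 _ _)
    (integrable_bounded_mul_inner p1.continuous p2 _ _), a, b]
  ring

theorem HasWeakDeriv.norm_sq_sub_norm_sq {j : V →L[ℝ] H} (hj : Function.Injective j)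
    {z G : Lp V 2 (timeMeasure T)} (hT : 0 < T) (h : HasWeakDeriv j z G) {y : ℝ → H}
    (hy : IsRep j z y) {s t : ℝ} (hs : 0 ≤ s) (hst : s ≤ t) (ht : t ≤ T) :
    ‖y t‖ ^ 2 - ‖y s‖ ^ 2 = 2 * ∫ τ in Ioo s t, ⟪G τ, z τ⟫_ℝ := by
  obtain ⟨y', h1, -, h3⟩ := h.exists_isRep hj hT
  have he := hy.eqOn hT h1
  rw [he ⟨hs.trans hst, ht⟩, he ⟨hs, hst.trans ht⟩, h3 s t hs hst ht]

/-- Integration by parts in `W(0, T; V)`. -/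
theorem HasWeakDeriv.inner_sub_inner {j : V →L[ℝ] H} (hj : Function.Injective j)
    {z₁ z₂ G₁ G₂ : Lp V 2 (timeMeasure T)} (hT : 0 < T) (h₁ : HasWeakDeriv j z₁ G₁)
    (h₂ : HasWeakDeriv j z₂ G₂) {y₁ y₂ : ℝ → H} (hy₁ : IsRep j z₁ y₁) (hy₂ : IsRep j z₂ y₂) :
    ⟪y₁ T, y₂ T⟫_ℝ - ⟪y₁ 0, y₂ 0⟫_ℝ = ⟪G₁, z₂⟫_ℝ + ⟪G₂, z₁⟫_ℝ := by
  have a := h₁.norm_sq_sub_norm_sq hj hT hy₁ le_rfl hT.le le_rfl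
  have b := h₂.norm_sq_sub_norm_sq hj hT hy₂ le_rfl hT.le le_rfl
  -- Polarization: the identities for the two summands are subtracted from the one for the sum.
  have c := (h₁.add h₂).norm_sq_sub_norm_sq hj hT (hy₁.add hy₂) le_rfl hT.le le_rfl
  change _ = 2 * ∫ τ, ⟪G₁ τ, z₁ τ⟫_ℝ ∂(timeMeasure T) at a
  change _ = 2 * ∫ τ, ⟪G₂ τ, z₂ τ⟫_ℝ ∂(timeMeasure T) at b
  change _ = 2 * ∫ τ, ⟪(G₁ + G₂) τ, (z₁ + z₂) τ⟫_ℝ ∂(timeMeasure T) at c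
  rw [← L2.inner_def] at a b c
  simp only [Pi.add_apply, norm_add_sq_real, inner_add_left, inner_add_right] at c
  linarith

end ContinuousRepresentative

/-! ### The abstract parabolic problem -/

section Parabolic

/-- The projection lemma of Lions. -/
theorem exists_inner_eq_of_abs_le {X E : Type*} [AddCommGroup X] [Module ℝ X]
    [NormedAddCommGroup E] [InnerProductSpace ℝ E] [CompleteSpace E] (K : X →ₗ[ℝ] E)
    (ℓ : X →ₗ[ℝ] ℝ) {C : ℝ} (h : ∀ x, |ℓ x| ≤ C * ‖K x‖) : ∃ z : E, ∀ x, ⟪z, K x⟫_ℝ = ℓ x := by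
  -- The bound lets `ℓ` factor through `K` as a bounded functional on the range; Hahn–Banach extends
  -- it to `E` and Riesz represents it.
  have hker : LinearMap.ker K ≤ LinearMap.ker ℓ := by
    intro x hx
    rw [LinearMap.mem_ker] at hx ⊢
    simpa [hx] using h x
  let g : LinearMap.range K →ₗ[ℝ] ℝ :=
    ((LinearMap.ker K).liftQ ℓ hker).comp K.quotKerEquivRange.symm.toLinearMap
  have hg : ∀ x, g ⟨K x, LinearMap.mem_range_self K x⟩ = ℓ x := by
    intro x
    simp only [g, LinearMap.comp_apply, LinearEquiv.coe_coe]
    rw [LinearMap.quotKerEquivRange_symm_apply_image, Submodule.mkQ_apply, Submodule.liftQ_apply]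
  let g' : StrongDual ℝ (LinearMap.range K) := g.mkContinuous C (by
    rintro ⟨_, x, rfl⟩
    exact (le_of_eq (congrArg _ (hg x))).trans (h x))
  obtain ⟨ext, hext, -⟩ := exists_extension_norm_eq _ g'
  refine ⟨(InnerProductSpace.toDual ℝ E).symm ext, fun x => ?_⟩
  rw [InnerProductSpace.toDual_symm_apply]
  exact (hext ⟨K x, LinearMap.mem_range_self K x⟩).trans (hg x)

variable {V H : Type*} [NormedAddCommGroup V] [InnerProductSpace ℝ V]
  [NormedAddCommGroup H] [InnerProductSpace ℝ H] {T : ℝ}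

theorem IsRep.smul {j : V →L[ℝ] H} {z : Lp V 2 (timeMeasure T)} {y : ℝ → H} (c : ℝ)
    (h : IsRep j z y) : IsRep j (c • z) (c • y) := by
  refine ⟨h.1.const_smul c, ?_⟩
  filter_upwards [h.2, Lp.coeFn_smul c z] with t a b
  rw [b, Pi.smul_apply, Pi.smul_apply, a, map_smul]

theorem HasWeakDeriv.smul {j : V →L[ℝ] H} {z G : Lp V 2 (timeMeasure T)} (c : ℝ)
    (h : HasWeakDeriv j z G) : HasWeakDeriv j (c • z) (c • G) := by
  intro ψ p1 p2 p3 w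
  have e1 : ∫ t in Ioo 0 T, deriv ψ t * ⟪j ((c • z) t), j w⟫_ℝ =
      c * ∫ t in Ioo 0 T, deriv ψ t * ⟪j (z t), j w⟫_ℝ := by
    rw [← integral_const_mul]
    refine integral_congr_ae ?_
    filter_upwards [Lp.coeFn_smul c z] with t ht
    rw [ht, Pi.smul_apply, map_smul, real_inner_smul_left]
    ring
  have e2 : ∫ t in Ioo 0 T, ψ t * ⟪(c • G) t, w⟫_ℝ =
      c * ∫ t in Ioo 0 T, ψ t * ⟪G t, w⟫_ℝ := by
    rw [← integral_const_mul]
    refine integral_congr_ae ?_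
    filter_upwards [Lp.coeFn_smul c G] with t ht
    rw [ht, Pi.smul_apply, real_inner_smul_left]
    ring
  rw [e1, e2, h ψ p1 p2 p3 w]
  ring

theorem hasWeakDeriv_zero (j : V →L[ℝ] H) :
    HasWeakDeriv j (0 : Lp V 2 (timeMeasure T)) 0 := by
  intro ψ _ _ _ w
  have h : ∀ᵐ t ∂(timeMeasure T), (0 : Lp V 2 (timeMeasure T)) t = 0 := Lp.coeFn_zero V 2 _
  rw [integral_eq_zero_of_ae, integral_eq_zero_of_ae, neg_zero]
  · filter_upwards [h] with t ht
    rw [ht, inner_zero_left, mul_zero, Pi.zero_apply]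
  · filter_upwards [h] with t ht
    rw [ht, map_zero, inner_zero_left, mul_zero, Pi.zero_apply]

theorem isRep_zero (j : V →L[ℝ] H) : IsRep j (0 : Lp V 2 (timeMeasure T)) 0 := by
  refine ⟨continuousOn_const, ?_⟩
  filter_upwards [Lp.coeFn_zero V 2 (timeMeasure T)] with t ht
  rw [ht, Pi.zero_apply, Pi.zero_apply, map_zero]

/-- The products `ψ(t) w` are the only test functions needed to identify `z_t` and the initial
value. -/
theorem memLp_smul_const {ψ : ℝ → ℝ} (hψ : Continuous ψ) (w : V) :
    MemLp (fun t => ψ t • w) 2 (timeMeasure T) := by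
  obtain ⟨M, hM⟩ := isCompact_Icc.exists_bound_of_continuousOn
    (hψ.smul (continuous_const (y := w))).continuousOn (s := Icc 0 T)
  refine MemLp.of_bound (hψ.smul continuous_const).aestronglyMeasurable M ?_
  filter_upwards [ae_restrict_mem measurableSet_Ioo] with t ht
  exact hM t (Ioo_subset_Icc_self ht)

theorem isRep_smul_const (j : V →L[ℝ] H) {ψ : ℝ → ℝ} (hψ : Continuous ψ) (w : V) :
    IsRep j ((memLp_smul_const (T := T) hψ w).toLp _) (fun t => ψ t • j w) := by
  refine ⟨(hψ.smul continuous_const).continuousOn, ?_⟩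
  filter_upwards [(memLp_smul_const (T := T) hψ w).coeFn_toLp] with t ht
  rw [ht, map_smul]

theorem inner_toLp_smul_const (x : Lp V 2 (timeMeasure T)) {ψ : ℝ → ℝ} (hψ : Continuous ψ)
    (w : V) :
    ⟪x, (memLp_smul_const (T := T) hψ w).toLp _⟫_ℝ = ∫ t in Ioo 0 T, ψ t * ⟪x t, w⟫_ℝ := by
  rw [L2.inner_def]
  refine integral_congr_ae ?_
  filter_upwards [(memLp_smul_const (T := T) hψ w).coeFn_toLp] with t ht
  rw [ht, real_inner_smul_right]

variable [CompleteSpace V] [CompleteSpace H]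

/-- The triples `(φ, φ_t, φ(0))` with `φ ∈ W(0, T; V)` and `φ(T) = 0`. -/
def testSpace (j : V →L[ℝ] H) :
    Submodule ℝ (Lp V 2 (timeMeasure T) × Lp V 2 (timeMeasure T) × H) where
  carrier := {p | HasWeakDeriv j p.1 p.2.1 ∧ ∃ y, IsRep j p.1 y ∧ y T = 0 ∧ y 0 = p.2.2}
  zero_mem' := ⟨hasWeakDeriv_zero j, 0, isRep_zero j, rfl, rfl⟩
  add_mem' := by
    rintro p q ⟨hp, y, h1, h2, h3⟩ ⟨hq, y', h1', h2', h3'⟩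
    exact ⟨hp.add hq, y + y', h1.add h1', by simp [h2, h2'], by simp [h3, h3']⟩
  smul_mem' := by
    rintro c p ⟨hp, y, h1, h2, h3⟩
    exact ⟨hp.smul c, c • y, h1.smul c, by simp [h2], by simp [h3]⟩

/-- Weak solutions of `z_t + z + B z = F`, `z(0) = ρ`, where functionals are represented by
elements of `V`. -/
def IsWeakSol (j : V →L[ℝ] H) (B : Lp V 2 (timeMeasure T) →L[ℝ] Lp V 2 (timeMeasure T))
    (F : Lp V 2 (timeMeasure T)) (ρ : H) (z : Lp V 2 (timeMeasure T)) : Prop :=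
  ∀ (φ Φ : Lp V 2 (timeMeasure T)) (y : ℝ → H), HasWeakDeriv j φ Φ → IsRep j φ y → y T = 0 →
    -⟪Φ, z⟫_ℝ + ⟪z, φ⟫_ℝ + ⟪B z, φ⟫_ℝ = ⟪F, φ⟫_ℝ + ⟪ρ, y 0⟫_ℝ

/-- The weak formulation reads `⟪z, K φ⟫ = ℓ φ` with `K φ = φ + B† φ - φ_t` and `ℓ φ = ⟪F, φ⟫ + ⟪ρ,
φ(0)⟫`, so only the bound of `ℓ` by `K` is at stake. -/
theorem exists_isWeakSol {j : V →L[ℝ] H} (hj : Function.Injective j) (hT : 0 < T)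
    {B : Lp V 2 (timeMeasure T) →L[ℝ] Lp V 2 (timeMeasure T)} (hB : ∀ z, 0 ≤ ⟪B z, z⟫_ℝ)
    (F : Lp V 2 (timeMeasure T)) (ρ : H) : ∃ z, IsWeakSol j B F ρ z := by
  let K₀ : Lp V 2 (timeMeasure T) × Lp V 2 (timeMeasure T) × H →L[ℝ] Lp V 2 (timeMeasure T) :=
    (ContinuousLinearMap.id ℝ _ + B.adjoint).comp (ContinuousLinearMap.fst ℝ _ _) -
      (ContinuousLinearMap.fst ℝ _ _).comp (ContinuousLinearMap.snd ℝ _ _)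
  let ℓ₀ : Lp V 2 (timeMeasure T) × Lp V 2 (timeMeasure T) × H →L[ℝ] ℝ :=
    (innerBilin _ F).comp (ContinuousLinearMap.fst ℝ _ _) +
      (innerBilin _ ρ).comp ((ContinuousLinearMap.snd ℝ _ _).comp (ContinuousLinearMap.snd ℝ _ _))
  have hK : ∀ p, K₀ p = p.1 + B.adjoint p.1 - p.2.1 := fun p => rfl
  have hℓ : ∀ p, ℓ₀ p = ⟪F, p.1⟫_ℝ + ⟪ρ, p.2.2⟫_ℝ := fun p => rfl
  obtain ⟨z, hz⟩ := exists_inner_eq_of_abs_le (K₀.toLinearMap.comp (testSpace (T := T) j).subtype)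
    (ℓ₀.toLinearMap.comp (testSpace (T := T) j).subtype) (C := ‖F‖ + 2 * ‖ρ‖) (by
    rintro ⟨⟨φ, Φ, h⟩, hd, y, h1, h2, h3⟩
    simp only [LinearMap.comp_apply, Submodule.subtype_apply, ContinuousLinearMap.coe_coe, hK, hℓ]
    simp only at hd h1 h3
    have e1 := hd.inner_sub_inner hj hT hd h1 h1
    rw [h2, h3, inner_zero_left, real_inner_self_eq_norm_sq] at e1
    have e2 : ⟪φ + B.adjoint φ - Φ, φ⟫_ℝ = ‖φ‖ ^ 2 + ⟪B φ, φ⟫_ℝ + ‖h‖ ^ 2 / 2 := by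
      rw [inner_sub_left, inner_add_left, ContinuousLinearMap.adjoint_inner_left,
        real_inner_self_eq_norm_sq, real_inner_comm]
      linarith
    have e3 := real_inner_le_norm (φ + B.adjoint φ - Φ) φ
    have e4 := hB φ
    set k := ‖φ + B.adjoint φ - Φ‖
    have hk : 0 ≤ k := norm_nonneg _
    -- By `e2` and `e3`, `‖φ‖² + ‖h‖² / 2 ≤ k ‖φ‖`. This gives `‖φ‖ ≤ k`, then `‖h‖² ≤ 2k² ≤ (2k)²`.
    have e5 : ‖φ‖ ≤ k := by
      by_contra hlt
      nlinarith [norm_nonneg φ, sq_nonneg ‖h‖]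
    have e6 : ‖h‖ ≤ 2 * k := by
      refine abs_le_of_sq_le_sq' ?_ (by positivity) |>.2
      nlinarith [norm_nonneg φ]
    calc |⟪F, φ⟫_ℝ + ⟪ρ, h⟫_ℝ| ≤ ‖F‖ * ‖φ‖ + ‖ρ‖ * ‖h‖ :=
          (abs_add_le _ _).trans (add_le_add (abs_real_inner_le_norm _ _)
            (abs_real_inner_le_norm _ _))
      _ ≤ ‖F‖ * k + ‖ρ‖ * (2 * k) := by gcongr
      _ = _ := by ring)
  refine ⟨z, fun φ Φ y hd hy hyT => ?_⟩
  have h := hz ⟨(φ, Φ, y 0), hd, y, hy, hyT, rfl⟩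
  simp only [LinearMap.comp_apply, Submodule.subtype_apply, ContinuousLinearMap.coe_coe, hK,
    hℓ] at h
  rw [← h, inner_sub_right, inner_add_right, ContinuousLinearMap.adjoint_inner_right,
    real_inner_comm z Φ]
  ring

/-- The derivative `ψ' w` acts as a functional through the pivot space, so its representative in `V`
carries the Gram operator. -/
theorem hasWeakDeriv_smul_const (j : V →L[ℝ] H) {ψ : ℝ → ℝ} (hψ : ContDiff ℝ 1 ψ) (w : V) :
    HasWeakDeriv j ((memLp_smul_const (T := T) hψ.continuous w).toLp _)
      ((memLp_smul_const (T := T) (hψ.continuous_deriv le_rfl) (gramOp j w)).toLp _) := by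
  intro η h1 h2 h3 v
  have hz : ∀ x, x ∉ Ioo 0 T → η x = 0 := fun x hx =>
    image_eq_zero_of_notMem_tsupport fun h => hx (h3 h)
  have a1 : ∫ t in Ioo 0 T, deriv η t *
      ⟪j ((memLp_smul_const (T := T) hψ.continuous w).toLp _ t), j v⟫_ℝ =
      ∫ t in Ioo 0 T, deriv η t * (ψ t * ⟪j w, j v⟫_ℝ) := by
    refine integral_congr_ae ?_
    filter_upwards [(memLp_smul_const (T := T) hψ.continuous w).coeFn_toLp] with t ht
    rw [ht, map_smul, real_inner_smul_left]
  have a2 : ∫ t in Ioo 0 T, η t *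
      ⟪(memLp_smul_const (T := T) (hψ.continuous_deriv le_rfl) (gramOp j w)).toLp _ t, v⟫_ℝ =
      ∫ t in Ioo 0 T, η t * (deriv ψ t * ⟪j w, j v⟫_ℝ) := by
    refine integral_congr_ae ?_
    filter_upwards [(memLp_smul_const (T := T) (hψ.continuous_deriv le_rfl)
      (gramOp j w)).coeFn_toLp] with t ht
    rw [ht, real_inner_smul_left, inner_gramOp_left]
  rw [a1, a2]
  simp only [← mul_assoc]
  rw [integral_mul_const, integral_mul_const, ← neg_mul]
  congr 1
  rcases le_or_gt T 0 with hT | hT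
  · simp [Ioo_eq_empty (not_lt.2 hT)]
  have hd1 : Continuous (deriv η) := h1.continuous_deriv (by simp)
  have hd2 : Continuous (deriv ψ) := hψ.continuous_deriv le_rfl
  have h := intervalIntegral.integral_mul_deriv_eq_deriv_mul (a := 0) (b := T) (u := η) (v := ψ)
    (fun x _ => ((h1.differentiable (by simp)) x).hasDerivAt)
    (fun x _ => ((hψ.differentiable one_ne_zero) x).hasDerivAt)
    (hd1.intervalIntegrable _ _) (hd2.intervalIntegrable _ _)
  rw [hz T (by simp), hz 0 (by simp), intervalIntegral.integral_of_le hT.le,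
    intervalIntegral.integral_of_le hT.le, integral_Ioc_eq_integral_Ioo,
    integral_Ioc_eq_integral_Ioo] at h
  linarith

variable {j : V →L[ℝ] H} {B : Lp V 2 (timeMeasure T) →L[ℝ] Lp V 2 (timeMeasure T)}
  {F z : Lp V 2 (timeMeasure T)} {ρ : H}

/-- For the test function `ψ(t) w` with `ψ` supported inside `(0, T)`, the endpoint terms vanish and
the weak formulation is the definition of the derivative. -/
theorem IsWeakSol.hasWeakDeriv (h : IsWeakSol j B F ρ z) :
    HasWeakDeriv j z (F - z - B z) := by
  intro ψ h1 h2 h3 w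
  have hz : ∀ x, x ∉ Ioo 0 T → ψ x = 0 := fun x hx =>
    image_eq_zero_of_notMem_tsupport fun h => hx (h3 h)
  have h1' : ContDiff ℝ 1 ψ := h1.of_le (by exact_mod_cast le_top)
  have e := h _ _ _ (hasWeakDeriv_smul_const j h1' w) (isRep_smul_const j h1'.continuous w)
    (by simp [hz T (by simp)])
  rw [hz 0 (by simp), zero_smul, inner_zero_right, add_zero, real_inner_comm,
    inner_toLp_smul_const z (h1'.continuous_deriv le_rfl)] at e
  simp only [inner_gramOp_right] at e
  rw [← inner_toLp_smul_const (F - z - B z) h1'.continuous w, inner_sub_left, inner_sub_left]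
  linarith

/-- In the energy identity on `(0, τ)`, Young's inequality `2⟪F, z⟫ ≤ ‖F‖² + ‖z‖²` absorbs one of
the two copies of `‖z‖²`, and the `B` term has a good sign. The remaining point is that `‖y 0‖ ≤
‖ρ‖`. -/
theorem IsWeakSol.estimates (hj : Function.Injective j) (hT : 0 < T)
    (hB : ∀ z τ, 0 ≤ τ → τ ≤ T → 0 ≤ ∫ t in Ioo 0 τ, ⟪B z t, z t⟫_ℝ) (h : IsWeakSol j B F ρ z) :
    (∃ y, IsRep j z y ∧ ∀ τ ∈ Icc 0 T, ‖y τ‖ ^ 2 ≤ ‖F‖ ^ 2 + ‖ρ‖ ^ 2) ∧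
      ‖z‖ ^ 2 ≤ ‖F‖ ^ 2 + ‖ρ‖ ^ 2 := by
  have hd := h.hasWeakDeriv
  obtain ⟨y, hy, hcl, hen⟩ := hd.exists_isRep hj hT
  have hinit : ∀ w, ⟪j w, y 0⟫_ℝ = ⟪ρ, j w⟫_ℝ := by
    intro w
    -- The weight `1 - t/T` equals 1 at 0 and 0 at `T`; comparing the weak formulation with
    -- integration by parts leaves only the initial values.
    have hψ : ContDiff ℝ 1 (fun t : ℝ => 1 - t / T) := by fun_prop
    have a1 := hasWeakDeriv_smul_const (T := T) j hψ w
    have a2 := isRep_smul_const (T := T) j hψ.continuous w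
    have a3 : (1 - T / T) • j w = 0 := by rw [div_self hT.ne', sub_self, zero_smul]
    have a4 := h _ _ _ a1 a2 a3
    have a5 := a1.inner_sub_inner hj hT hd a2 hy
    simp only [a3, inner_zero_left, zero_div, sub_zero, one_smul, zero_sub, inner_sub_left]
      at a4 a5
    linarith
  -- The identity `hinit` extends to the closure of the range of `j`, which contains `y 0`. Hence `y
  -- 0` may itself be inserted, and density of the range is not needed.
  have h0 : ‖y 0‖ ≤ ‖ρ‖ := by
    have hc : IsClosed {x : H | ⟪x, y 0⟫_ℝ = ⟪ρ, x⟫_ℝ} :=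
      isClosed_eq (continuous_id.inner continuous_const) (continuous_const.inner continuous_id)
    have hm : y 0 ∈ {x : H | ⟪x, y 0⟫_ℝ = ⟪ρ, x⟫_ℝ} :=
      closure_minimal (by rintro _ ⟨w, rfl⟩; exact hinit w) hc (hcl 0 ⟨le_rfl, hT.le⟩)
    have h1 : ‖y 0‖ ^ 2 ≤ ‖ρ‖ * ‖y 0‖ := by
      rw [← real_inner_self_eq_norm_sq, show ⟪y 0, y 0⟫_ℝ = ⟪ρ, y 0⟫_ℝ from hm]
      exact real_inner_le_norm _ _
    by_contra hlt
    nlinarith [norm_nonneg ρ]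
  have hF2 : IntegrableOn (fun t => ‖F t‖ ^ 2) (Ioo 0 T) :=
    (Lp.memLp F).integrable_norm_pow (by norm_num)
  have hz2 : IntegrableOn (fun t => ‖z t‖ ^ 2) (Ioo 0 T) :=
    (Lp.memLp z).integrable_norm_pow (by norm_num)
  have hmain : ∀ τ ∈ Icc 0 T,
      ‖y τ‖ ^ 2 + ∫ t in Ioo 0 τ, ‖z t‖ ^ 2 ≤ ‖F‖ ^ 2 + ‖ρ‖ ^ 2 := by
    intro τ hτ
    have hsub : Ioo 0 τ ⊆ Ioo 0 T := Ioo_subset_Ioo_right hτ.2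
    have e1 := hen 0 τ le_rfl hτ.1 hτ.2
    have iF : IntegrableOn (fun t => ⟪F t, z t⟫_ℝ) (Ioo 0 τ) :=
      IntegrableOn.mono_set (L2.integrable_inner F z) hsub
    have iB : IntegrableOn (fun t => ⟪B z t, z t⟫_ℝ) (Ioo 0 τ) :=
      IntegrableOn.mono_set (L2.integrable_inner (B z) z) hsub
    have iz := hz2.mono_set hsub
    have e2 : ∫ t in Ioo 0 τ, ⟪(F - z - B z) t, z t⟫_ℝ =
        ∫ t in Ioo 0 τ, (⟪F t, z t⟫_ℝ - ‖z t‖ ^ 2 - ⟪B z t, z t⟫_ℝ) := by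
      refine integral_congr_ae (ae_restrict_of_ae_restrict_of_subset hsub ?_)
      filter_upwards [Lp.coeFn_sub (F - z) (B z), Lp.coeFn_sub F z] with t b1 b2
      rw [b1, Pi.sub_apply, b2, Pi.sub_apply, inner_sub_left, inner_sub_left,
        real_inner_self_eq_norm_sq]
    have iFz : IntegrableOn (fun t => ⟪F t, z t⟫_ℝ - ‖z t‖ ^ 2) (Ioo 0 τ) := iF.sub iz
    rw [e2, integral_sub iFz iB, integral_sub iF iz] at e1
    have e3 : ∫ t in Ioo 0 τ, ⟪F t, z t⟫_ℝ ≤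
        ∫ t in Ioo 0 τ, (1 / 2 * ‖F t‖ ^ 2 + 1 / 2 * ‖z t‖ ^ 2) := by
      refine integral_mono iF (((hF2.mono_set hsub).const_mul _).add (iz.const_mul _)) fun t => ?_
      have := real_inner_le_norm (F t) (z t)
      simp only
      nlinarith [sq_nonneg (‖F t‖ - ‖z t‖)]
    rw [integral_add ((hF2.mono_set hsub).const_mul _) (iz.const_mul _), integral_const_mul,
      integral_const_mul] at e3
    have e4 : ∫ t in Ioo 0 τ, ‖F t‖ ^ 2 ≤ ‖F‖ ^ 2 := by
      rw [lp_two_norm_sq]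
      exact setIntegral_mono_set hF2 (Eventually.of_forall fun t => by positivity)
        (Eventually.of_forall hsub)
    have e5 := hB z τ hτ.1 hτ.2
    have e6 := pow_le_pow_left₀ (norm_nonneg _) h0 2
    linarith
  refine ⟨⟨y, hy, fun τ hτ => ?_⟩, ?_⟩
  · have h1 : 0 ≤ ∫ t in Ioo 0 τ, ‖z t‖ ^ 2 := integral_nonneg fun t => by positivity
    linarith [hmain τ hτ]
  · rw [lp_two_norm_sq z]
    have h1 := hmain T ⟨hT.le, le_rfl⟩
    have h2 := sq_nonneg ‖y T‖
    linarith

theorem IsWeakSol.eq (hj : Function.Injective j) (hT : 0 < T)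
    (hB : ∀ z τ, 0 ≤ τ → τ ≤ T → 0 ≤ ∫ t in Ioo 0 τ, ⟪B z t, z t⟫_ℝ) (h : IsWeakSol j B F ρ z)
    {z' : Lp V 2 (timeMeasure T)} (h' : IsWeakSol j B F ρ z') : z' = z := by
  have hd : IsWeakSol j B 0 0 (z' - z) := by
    intro φ Φ y h1 h2 h3
    have a := h φ Φ y h1 h2 h3
    have b := h' φ Φ y h1 h2 h3
    simp only [map_sub, inner_sub_left, inner_sub_right, inner_zero_left]
    linarith
  have h1 := (hd.estimates hj hT hB).2
  have h2 : ‖z' - z‖ = 0 := by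
    simp only [norm_zero] at h1
    nlinarith [norm_nonneg (z' - z)]
  exact sub_eq_zero.1 (norm_eq_zero.1 h2)

end Parabolic

/-! ### The space `H₀ˢ(Ω)`: Poincaré inequality, embedding, completeness -/

section FractionalSpace

variable {N : ℕ} {s : Ioo (0 : ℝ) 1} {Ω : Set (Euc N)}

theorem HZero.fn_ae_zero (u : HZero s Ω) : ∀ᵐ x, x ∉ Ω → u.fn x = 0 := u.2.2

theorem HZero.fn_measurable (u : HZero s Ω) : Measurable u.fn := lp_measurable _

theorem HZero.toL2_coeFn (u : HZero s Ω) : u.toL2 =ᵐ[volume.restrict Ω] u.fn :=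
  MemLp.coeFn_toLp _

theorem HZero.norm_sq_eq [NeZero N] (u : HZero s Ω) :
    ‖u‖ ^ 2 = fracConst N s / 2 * ∫ p : Euc N × Euc N, fracIntegrand (s : ℝ) u.fn u.fn p := by
  rw [← real_inner_self_eq_norm_sq, HZero.inner_eq, fracForm]

theorem HZero.norm_toL2_le (u : HZero s Ω) : ‖u.toL2‖ ≤ ‖u.incl‖ := by
  change ‖MemLp.toLp (u.incl : Euc N → ℝ) ((Lp.memLp u.incl).restrict Ω)‖ ≤ _
  rw [Lp.norm_toLp, Lp.norm_def]
  exact ENNReal.toReal_mono (Lp.eLpNorm_ne_top _) (eLpNorm_mono_measure _ Measure.restrict_le_self)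

/-- The fractional Poincaré inequality. -/
theorem HZero.exists_norm_incl_le [NeZero N] (hΩ : Bornology.IsBounded Ω) :
    ∃ c : ℝ, 0 ≤ c ∧ ∀ u : HZero s Ω, ‖u.incl‖ ≤ c * ‖u‖ := by
  obtain ⟨R₀, hR₀⟩ := hΩ.subset_ball (0 : Euc N)
  set R : ℝ := max R₀ 1 with hR
  have hRpos : 0 < R := lt_of_lt_of_le one_pos (le_max_right _ _)
  have hΩR : ∀ x ∈ Ω, ‖x‖ < R := fun x hx => by
    have := hR₀ hx
    rw [mem_ball_zero_iff] at this
    exact this.trans_le (le_max_left _ _)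
  have : Nontrivial (Euc N) := by
    apply Module.nontrivial_of_finrank_pos (R := ℝ)
    simpa using Nat.pos_of_ne_zero (NeZero.ne N)
  -- A ball of radius `R` about a point of norm `2R` misses `Ω`, which lies in the ball of radius
  -- `R` about 0; points of the two balls are less than `4R` apart.
  obtain ⟨a, ha⟩ := exists_norm_eq (Euc N) (c := 2 * R) (by positivity)
  set A := Metric.ball a R with hA
  have hAΩ : ∀ y ∈ A, y ∉ Ω ∧ ‖y‖ < 3 * R := by
    intro y hy
    rw [hA, mem_ball_iff_norm] at hy
    have h1 : ‖a‖ ≤ ‖y‖ + ‖y - a‖ := by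
      calc ‖a‖ = ‖y - (y - a)‖ := by rw [sub_sub_cancel]
        _ ≤ _ := norm_sub_le _ _
    have h2 : ‖y‖ ≤ ‖y - a‖ + ‖a‖ := by
      calc ‖y‖ = ‖(y - a) + a‖ := by rw [sub_add_cancel]
        _ ≤ _ := norm_add_le _ _
    refine ⟨fun h => ?_, by linarith⟩
    have := hΩR y h
    linarith
  have hs0 : 0 < (s : ℝ) := s.2.1
  set e : ℝ := (N : ℝ) + 2 * (s : ℝ) with he
  have he0 : 0 < e := by positivity
  set k : ℝ := ((4 * R) ^ e)⁻¹ with hk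
  have hk0 : 0 < k := by positivity
  set m : ℝ := volume.real A with hm
  have hm0 : 0 < m := by
    rw [hm, Measure.real, ENNReal.toReal_pos_iff]
    exact ⟨Metric.measure_ball_pos _ _ hRpos, measure_ball_lt_top⟩
  have hC := fracConst_pos N s
  have hmain : ∀ u : HZero s Ω, ‖u.incl‖ ^ 2 * (k * m) ≤ 2 / fracConst N s * ‖u‖ ^ 2 := by
    intro u
    have hu2 : Integrable (fun x => u.fn x ^ 2) := (Lp.memLp u.incl).integrable_sq
    have hA1 : Integrable (A.indicator fun _ : Euc N => (1 : ℝ)) :=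
      (integrable_indicator_iff measurableSet_ball).2
        (integrableOn_const (hs := measure_ball_lt_top.ne))
    have hint := (hu2.const_mul k).mul_prod hA1
    -- Only the pairs with `x ∈ Ω` and `y ∈ A` are kept: there `u(y) = 0` and the kernel is at least
    -- `k`.
    have hle : (fun p : Euc N × Euc N => k * u.fn p.1 ^ 2 * A.indicator (fun _ => (1 : ℝ)) p.2)
        ≤ᵐ[volume.prod volume] fracIntegrand (s : ℝ) u.fn u.fn := by
      have h1 := Measure.quasiMeasurePreserving_fst (μ := (volume : Measure (Euc N)))
        (ν := (volume : Measure (Euc N)))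
      have h2 := Measure.quasiMeasurePreserving_snd (μ := (volume : Measure (Euc N)))
        (ν := (volume : Measure (Euc N)))
      filter_upwards [h1.ae u.fn_ae_zero, h2.ae u.fn_ae_zero] with p hp1 hp2
      by_cases hy : p.2 ∈ A
      · by_cases hx : p.1 ∈ Ω
        · have hpy := hp2 (hAΩ _ hy).1
          simp only [fracIntegrand, hpy, sub_zero, indicator_of_mem hy, mul_one]
          have hne : 0 < ‖p.1 - p.2‖ := by
            rw [norm_pos_iff, sub_ne_zero]
            rintro h
            exact (hAΩ _ hy).1 (h ▸ hx)
          have hup : ‖p.1 - p.2‖ ≤ 4 * R := by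
            have := norm_sub_le p.1 p.2
            linarith [hΩR _ hx, (hAΩ _ hy).2]
          rw [← pow_two, mul_comm, hk, ← div_eq_mul_inv]
          exact div_le_div_of_nonneg_left (sq_nonneg _) (Real.rpow_pos_of_pos hne _)
            (Real.rpow_le_rpow hne.le hup he0.le)
        · simp only [hp1 hx]
          rw [zero_pow two_ne_zero, mul_zero, zero_mul]
          exact fracIntegrand_self_nonneg _ _
      · rw [indicator_of_notMem hy, mul_zero]
        exact fracIntegrand_self_nonneg _ _
    have h3 := integral_mono_ae hint (u.integrable u) hle
    rw [integral_prod_mul (fun x => k * u.fn x ^ 2) (A.indicator fun _ : Euc N => (1 : ℝ)),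
      integral_indicator measurableSet_ball, integral_const_mul] at h3
    have h4 : ∫ x, u.fn x ^ 2 = ‖u.incl‖ ^ 2 := by
      rw [lp_two_norm_sq]
      simp only [Real.norm_eq_abs, sq_abs]
      rfl
    have h5 : ∫ x in A, (1 : ℝ) = m := by simp [hm]
    have h6 : 2 / fracConst N s * ‖u‖ ^ 2 =
        ∫ p : Euc N × Euc N, fracIntegrand (s : ℝ) u.fn u.fn p := by
      rw [u.norm_sq_eq]
      field_simp
    rw [h6, Measure.volume_eq_prod]
    refine le_trans (le_of_eq ?_) h3
    rw [h4, h5]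
    ring
  refine ⟨√(2 / fracConst N s / (k * m)), Real.sqrt_nonneg _, fun u => ?_⟩
  refine abs_le_of_sq_le_sq' ?_ (by positivity) |>.2
  rw [mul_pow, Real.sq_sqrt (by positivity), div_mul_eq_mul_div, le_div_iff₀ (by positivity)]
  exact hmain u

theorem HZero.toL2_add (u w : HZero s Ω) : (u + w).toL2 = u.toL2 + w.toL2 := by
  apply Lp.ext
  have h : (u + w).fn =ᵐ[volume] u.fn + w.fn := Lp.coeFn_add u.incl w.incl
  filter_upwards [(u + w).toL2_coeFn, u.toL2_coeFn, w.toL2_coeFn, ae_restrict_of_ae h,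
    Lp.coeFn_add u.toL2 w.toL2] with x a b c d e
  rw [a, d, e, Pi.add_apply, Pi.add_apply, b, c]

theorem HZero.toL2_smul (c : ℝ) (u : HZero s Ω) : (c • u).toL2 = c • u.toL2 := by
  apply Lp.ext
  have h : (c • u).fn =ᵐ[volume] c • u.fn := Lp.coeFn_smul c u.incl
  filter_upwards [(c • u).toL2_coeFn, u.toL2_coeFn, ae_restrict_of_ae h,
    Lp.coeFn_smul c u.toL2] with x a b d e
  rw [a, d, e, Pi.smul_apply, Pi.smul_apply, b]

/-- The embedding `H₀ˢ(Ω) → L²(Ω)` as a linear map. -/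
noncomputable def HZero.toL2Lin : HZero s Ω →ₗ[ℝ] Lp ℝ 2 (volume.restrict Ω) where
  toFun := HZero.toL2
  map_add' := HZero.toL2_add
  map_smul' := HZero.toL2_smul

theorem HZero.exists_embedding [NeZero N] (hΩ : Bornology.IsBounded Ω) :
    ∃ j : HZero s Ω →L[ℝ] Lp ℝ 2 (volume.restrict Ω), ∀ u, j u = u.toL2 := by
  obtain ⟨c, -, hc⟩ := HZero.exists_norm_incl_le (s := s) hΩ
  have h : ∀ u : HZero s Ω, ‖HZero.toL2Lin (s := s) (Ω := Ω) u‖ ≤ c * ‖u‖ := fun u => u.norm_toL2_le.trans (hc u)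
  refine ⟨(HZero.toL2Lin (s := s) (Ω := Ω)).mkContinuous c h, fun u => ?_⟩
  rw [LinearMap.mkContinuous_apply]
  rfl

theorem HZero.toL2_injective (hΩ : MeasurableSet Ω) :
    Function.Injective (HZero.toL2 : HZero s Ω → _) := by
  intro u w h
  apply Subtype.ext
  apply Lp.ext
  have h1 : ∀ᵐ x ∂(volume.restrict Ω), u.fn x = w.fn x := by
    filter_upwards [u.toL2_coeFn, w.toL2_coeFn] with x a b
    rw [← a, ← b, h]
  rw [ae_restrict_iff' hΩ] at h1
  filter_upwards [h1, u.fn_ae_zero, w.fn_ae_zero] with x a b c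
  by_cases hx : x ∈ Ω
  · exact a hx
  · exact (b hx).trans (c hx).symm

theorem HZero.integral_mul_eq_inner (u w : HZero s Ω) :
    ∫ x in Ω, u.fn x * w.fn x = ⟪u.toL2, w.toL2⟫_ℝ := by
  rw [L2.inner_def]
  refine integral_congr_ae ?_
  filter_upwards [u.toL2_coeFn, w.toL2_coeFn] with x a b
  rw [a, b, RCLike.inner_apply, conj_trivial, mul_comm]

/-- The weighted difference quotient, whose `L²` norm is the norm of `H₀ˢ(Ω)`. -/
noncomputable def fracQuotient (s : ℝ) (u : Euc N → ℝ) (p : Euc N × Euc N) : ℝ :=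
  √(fracConst N s / 2) * ((u p.1 - u p.2) / ‖p.1 - p.2‖ ^ (((N : ℝ) + 2 * s) / 2))

theorem fracQuotient_measurable {s : ℝ} {u : Euc N → ℝ} (hu : Measurable u) :
    Measurable (fracQuotient s u) := by
  unfold fracQuotient
  fun_prop

theorem fracQuotient_sq (s : Ioo (0 : ℝ) 1) (u : Euc N → ℝ) (p : Euc N × Euc N) :
    fracQuotient (s : ℝ) u p ^ 2 = fracConst N s / 2 * fracIntegrand (s : ℝ) u u p := by
  have hC := fracConst_pos N s
  rw [fracQuotient, mul_pow, Real.sq_sqrt (by positivity), div_pow, fracIntegrand, ← pow_two,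
    ← Real.rpow_mul_natCast (norm_nonneg _)]
  norm_num

theorem memLp_fracQuotient {u : Euc N → ℝ} (hu : Measurable u) :
    MemLp (fracQuotient (s : ℝ) u) 2 ↔ Integrable (fracIntegrand (s : ℝ) u u) := by
  have hC := fracConst_pos N s
  rw [memLp_two_iff_integrable_sq (fracQuotient_measurable hu).aestronglyMeasurable]
  simp only [fracQuotient_sq]
  exact integrable_const_mul_iff (IsUnit.mk0 _ (by positivity)) _

theorem HZero.memLp_fracQuotient (u : HZero s Ω) : MemLp (fracQuotient (s : ℝ) u.fn) 2 :=
  (_root_.memLp_fracQuotient u.fn_measurable).2 (u.integrable u)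

/-- `fracQuotient` as an element of `L²`. -/
noncomputable def HZero.quotient (u : HZero s Ω) : Lp ℝ 2 (volume : Measure (Euc N × Euc N)) :=
  u.memLp_fracQuotient.toLp _

theorem HZero.norm_quotient [NeZero N] (u : HZero s Ω) : ‖u.quotient‖ = ‖u‖ := by
  rw [← sq_eq_sq₀ (norm_nonneg _) (norm_nonneg _), u.norm_sq_eq, lp_two_norm_sq,
    ← integral_const_mul]
  refine integral_congr_ae ?_
  filter_upwards [u.memLp_fracQuotient.coeFn_toLp] with p hp
  rw [HZero.quotient, hp, Real.norm_eq_abs, sq_abs, fracQuotient_sq]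

theorem HZero.quotient_sub (u w : HZero s Ω) : (u - w).quotient = u.quotient - w.quotient := by
  apply Lp.ext
  have h : (u - w).fn =ᵐ[volume] u.fn - w.fn := Lp.coeFn_sub u.incl w.incl
  have h1 := Measure.quasiMeasurePreserving_fst (μ := (volume : Measure (Euc N)))
    (ν := (volume : Measure (Euc N)))
  have h2 := Measure.quasiMeasurePreserving_snd (μ := (volume : Measure (Euc N)))
    (ν := (volume : Measure (Euc N)))
  filter_upwards [(u - w).memLp_fracQuotient.coeFn_toLp, u.memLp_fracQuotient.coeFn_toLp,
    w.memLp_fracQuotient.coeFn_toLp, h1.ae h, h2.ae h, Lp.coeFn_sub u.quotient w.quotient]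
    with p a b c d e f
  rw [f, Pi.sub_apply, HZero.quotient, HZero.quotient, HZero.quotient, a, b, c, fracQuotient,
    fracQuotient, fracQuotient, d, e, Pi.sub_apply, Pi.sub_apply]
  ring

/-- Difference quotients embed the space isometrically into `L²(ℝ^N × ℝ^N)`. For a Cauchy sequence
the quotients converge there, and by Poincaré the functions converge in `L²(ℝ^N)`; almost everywhere
convergence shows that the first limit is the quotient of the second. -/
theorem HZero.completeSpace [NeZero N] (hΩ : Bornology.IsBounded Ω) :
    CompleteSpace (HZero s Ω) := by
  obtain ⟨c, hc0, hc⟩ := HZero.exists_norm_incl_le (s := s) hΩ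
  refine Metric.complete_of_cauchySeq_tendsto fun u hu => ?_
  have hq : CauchySeq fun n => (u n).quotient := by
    rw [Metric.cauchySeq_iff] at hu ⊢
    intro ε hε
    obtain ⟨n₀, h⟩ := hu ε hε
    refine ⟨n₀, fun m hm n hn => ?_⟩
    rw [dist_eq_norm, ← HZero.quotient_sub, HZero.norm_quotient, ← dist_eq_norm]
    exact h m hm n hn
  have hi : CauchySeq fun n => (u n).incl :=
    ((HZero.incl (s := s) (Ω := Ω)).mkContinuous c hc).uniformContinuous.comp_cauchySeq hu
  obtain ⟨g, hg⟩ := cauchySeq_tendsto_of_complete hq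
  obtain ⟨w, hw⟩ := cauchySeq_tendsto_of_complete hi
  -- The second subsequence is extracted from the first, so both limits hold along `α ∘ β`.
  obtain ⟨α, hα, hαw⟩ := (tendstoInMeasure_of_tendsto_Lp hw).exists_seq_tendsto_ae
  obtain ⟨β, hβ, hβg⟩ :=
    (tendstoInMeasure_of_tendsto_Lp (hg.comp hα.tendsto_atTop)).exists_seq_tendsto_ae
  have hquot : fracQuotient (s : ℝ) w =ᵐ[volume] g := by
    have h1 := Measure.quasiMeasurePreserving_fst (μ := (volume : Measure (Euc N)))
      (ν := (volume : Measure (Euc N)))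
    have h2 := Measure.quasiMeasurePreserving_snd (μ := (volume : Measure (Euc N)))
      (ν := (volume : Measure (Euc N)))
    have h3 : ∀ᵐ p : Euc N × Euc N, ∀ n, (u n).quotient p = fracQuotient (s : ℝ) (u n).fn p :=
      ae_all_iff.2 fun n => (u n).memLp_fracQuotient.coeFn_toLp
    filter_upwards [h1.ae hαw, h2.ae hαw, h3, hβg] with p a b d e
    have h4 : Tendsto (fun n => fracQuotient (s : ℝ) (u (α (β n))).fn p) atTop
        (𝓝 (fracQuotient (s : ℝ) w p)) := by
      refine Tendsto.const_mul _ (Tendsto.div_const (Tendsto.sub ?_ ?_) _)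
      · exact a.comp hβ.tendsto_atTop
      · exact b.comp hβ.tendsto_atTop
    refine tendsto_nhds_unique h4 (e.congr fun n => ?_)
    exact d _
  have hwint : Integrable (fracIntegrand (s : ℝ) w w) :=
    (_root_.memLp_fracQuotient (lp_measurable w)).1 ((memLp_congr_ae hquot).2 (Lp.memLp g))
  have hw0 : ∀ᵐ x ∂(volume : Measure (Euc N)), x ∉ Ω → w x = 0 := by
    have h3 : ∀ᵐ x : Euc N, ∀ n, x ∉ Ω → (u n).fn x = 0 :=
      ae_all_iff.2 fun n => (u n).fn_ae_zero
    filter_upwards [h3, hαw] with x a b hx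
    refine tendsto_nhds_unique b (tendsto_const_nhds.congr fun n => ?_)
    exact (a _ hx).symm
  let W : HZero s Ω := ⟨w, hwint, hw0⟩
  have hW : W.quotient = g := by
    apply Lp.ext
    filter_upwards [W.memLp_fracQuotient.coeFn_toLp, hquot] with p a b
    exact a.trans b
  refine ⟨W, ?_⟩
  rw [tendsto_iff_norm_sub_tendsto_zero] at hg ⊢
  refine hg.congr fun n => ?_
  rw [← HZero.norm_quotient, HZero.quotient_sub, hW]

end FractionalSpace

/-! ### Operators induced by time dependent forms -/

section TimeDependentForm

variable {V H : Type*} [NormedAddCommGroup V] [InnerProductSpace ℝ V]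
  [NormedAddCommGroup H] [InnerProductSpace ℝ H] {T : ℝ}

/-- A Carathéodory argument: the form is continuous in its two vectors and measurable in `t`, hence
jointly measurable because `H` is second countable. -/
theorem aestronglyMeasurable_timeForm [SecondCountableTopology H] {μ : Measure ℝ}
    {b : ℝ → H →L[ℝ] H →L[ℝ] ℝ} (hb : ∀ h k, StronglyMeasurable fun t => b t h k)
    {f g : ℝ → H} (hf : AEStronglyMeasurable f μ) (hg : AEStronglyMeasurable g μ) :
    AEStronglyMeasurable (fun t => b t (f t) (g t)) μ := by
  borelize H
  have h := stronglyMeasurable_uncurry_of_continuous_of_stronglyMeasurable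
    (u := fun (p : H × H) t => b t p.1 p.2)
    (fun t => (b t).continuous₂) (fun p => hb p.1 p.2)
  refine ⟨fun t => b t (hf.mk f t) (hg.mk g t), ?_, ?_⟩
  · exact h.comp_measurable ((hf.stronglyMeasurable_mk.measurable.prodMk
      hg.stronglyMeasurable_mk.measurable).prodMk measurable_id)
  · filter_upwards [hf.ae_eq_mk, hg.ae_eq_mk] with t h1 h2
    rw [← h1, ← h2]

theorem norm_timeForm_le (j : V →L[ℝ] H) {b : H →L[ℝ] H →L[ℝ] ℝ} {M : ℝ} (hM : ‖b‖ ≤ M) (u w : V) :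
    ‖b (j u) (j w)‖ ≤ M * ‖j‖ ^ 2 * (‖u‖ * ‖w‖) := by
  have hM0 : 0 ≤ M := (norm_nonneg b).trans hM
  calc ‖b (j u) (j w)‖ ≤ ‖b‖ * ‖j u‖ * ‖j w‖ := b.le_opNorm₂ _ _
    _ ≤ M * (‖j‖ * ‖u‖) * (‖j‖ * ‖w‖) := by
      gcongr
      · exact j.le_opNorm u
      · exact j.le_opNorm w
    _ = _ := by ring

theorem integrable_timeForm [SecondCountableTopology H] (j : V →L[ℝ] H)
    {b : ℝ → H →L[ℝ] H →L[ℝ] ℝ} (hb : ∀ h k, StronglyMeasurable fun t => b t h k)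
    {M : ℝ} (hM : ∀ t, ‖b t‖ ≤ M) (z φ : Lp V 2 (timeMeasure T)) :
    Integrable (fun t => b t (j (z t)) (j (φ t))) (timeMeasure T) := by
  have hprod : Integrable (fun t => ‖z t‖ * ‖φ t‖) (timeMeasure T) :=
    (Lp.memLp z).norm.integrable_mul (Lp.memLp φ).norm
  refine (hprod.const_mul (M * ‖j‖ ^ 2)).mono' (aestronglyMeasurable_timeForm hb
    (j.continuous.comp_aestronglyMeasurable (Lp.aestronglyMeasurable z))
    (j.continuous.comp_aestronglyMeasurable (Lp.aestronglyMeasurable φ))) ?_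
  exact Eventually.of_forall fun t => norm_timeForm_le j (hM t) _ _

/-- The operator on `L²(0, T; V)` induced by a time dependent bilinear form on the pivot space. -/
theorem exists_timeForm_operator [CompleteSpace V] [SecondCountableTopology H] (j : V →L[ℝ] H)
    {b : ℝ → H →L[ℝ] H →L[ℝ] ℝ} (hb : ∀ h k, StronglyMeasurable fun t => b t h k)
    {M : ℝ} (hM : ∀ t, ‖b t‖ ≤ M) (hpos : ∀ t h, 0 ≤ b t h h) :
    ∃ B : Lp V 2 (timeMeasure T) →L[ℝ] Lp V 2 (timeMeasure T),
      (∀ z φ, ⟪B z, φ⟫_ℝ = ∫ t in Ioo 0 T, b t (j (z t)) (j (φ t))) ∧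
      (∀ z, ‖B z‖ ≤ M * ‖j‖ ^ 2 * ‖z‖) ∧
      ∀ z τ, 0 ≤ τ → τ ≤ T → 0 ≤ ∫ t in Ioo 0 τ, ⟪B z t, z t⟫_ℝ := by
  have hM0 : 0 ≤ M := (norm_nonneg (b 0)).trans (hM 0)
  have hint := fun z φ : Lp V 2 (timeMeasure T) => integrable_timeForm j hb hM z φ
  let β₀ : Lp V 2 (timeMeasure T) →ₗ[ℝ] Lp V 2 (timeMeasure T) →ₗ[ℝ] ℝ :=
    LinearMap.mk₂ ℝ (fun z φ => ∫ t in Ioo 0 T, b t (j (z t)) (j (φ t)))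
      (fun z₁ z₂ φ => by
        rw [← integral_add (hint _ _) (hint _ _)]
        refine integral_congr_ae ?_
        filter_upwards [Lp.coeFn_add z₁ z₂] with t ht
        rw [ht, Pi.add_apply, map_add, map_add, add_apply])
      (fun c z φ => by
        rw [smul_eq_mul, ← integral_const_mul]
        refine integral_congr_ae ?_
        filter_upwards [Lp.coeFn_smul c z] with t ht
        rw [ht, Pi.smul_apply, map_smul, map_smul, smul_apply, smul_eq_mul])
      (fun z φ₁ φ₂ => by
        rw [← integral_add (hint _ _) (hint _ _)]
        refine integral_congr_ae ?_
        filter_upwards [Lp.coeFn_add φ₁ φ₂] with t ht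
        rw [ht, Pi.add_apply, map_add, map_add])
      (fun c z φ => by
        rw [smul_eq_mul, ← integral_const_mul]
        refine integral_congr_ae ?_
        filter_upwards [Lp.coeFn_smul c φ] with t ht
        rw [ht, Pi.smul_apply, map_smul, map_smul, smul_eq_mul])
  have hbound : ∀ z φ, ‖β₀ z φ‖ ≤ M * ‖j‖ ^ 2 * ‖z‖ * ‖φ‖ := by
    intro z φ
    have hprod : Integrable (fun t => ‖z t‖ * ‖φ t‖) (timeMeasure T) :=
      (Lp.memLp z).norm.integrable_mul (Lp.memLp φ).norm
    calc ‖β₀ z φ‖ ≤ ∫ t in Ioo 0 T, M * ‖j‖ ^ 2 * (‖z t‖ * ‖φ t‖) :=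
          norm_integral_le_of_norm_le (hprod.const_mul _)
            (Eventually.of_forall fun t => norm_timeForm_le j (hM t) _ _)
      _ = M * ‖j‖ ^ 2 * ∫ t in Ioo 0 T, ‖z t‖ * ‖φ t‖ := integral_const_mul _ _
      _ ≤ M * ‖j‖ ^ 2 * (‖z‖ * ‖φ‖) := by
          gcongr
          exact integral_norm_mul_norm_le z φ
      _ = _ := by ring
  let β := β₀.mkContinuous₂ (M * ‖j‖ ^ 2) hbound
  have hβ : ∀ z φ, ⟪InnerProductSpace.continuousLinearMapOfBilin (𝕜 := ℝ) β z, φ⟫_ℝ =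
      ∫ t in Ioo 0 T, b t (j (z t)) (j (φ t)) := fun z φ =>
    InnerProductSpace.continuousLinearMapOfBilin_apply (𝕜 := ℝ) β z φ
  refine ⟨InnerProductSpace.continuousLinearMapOfBilin (𝕜 := ℝ) β, hβ, fun z => ?_,
    fun z τ h0 hτ => ?_⟩
  · set y := InnerProductSpace.continuousLinearMapOfBilin (𝕜 := ℝ) β z with hy
    rcases (norm_nonneg y).eq_or_lt with h | h
    · rw [← h]
      positivity
    · refine le_of_mul_le_mul_right ?_ h
      rw [← real_inner_self_eq_norm_mul_norm, hy, hβ, ← hy]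
      exact (le_abs_self _).trans (hbound z y)
  · set y := InnerProductSpace.continuousLinearMapOfBilin (𝕜 := ℝ) β z with hy
    have hsub : Ioo 0 τ ⊆ Ioo 0 T := Ioo_subset_Ioo_right hτ
    -- The form is local in time: pairing `B z` with `z` cut off to `(0, τ)` integrates `b` over
    -- `(0, τ)` only.
    have hm := (Lp.memLp z).indicator (measurableSet_Ioo (a := 0) (b := τ))
    have e1 : ∫ t in Ioo 0 τ, ⟪y t, z t⟫_ℝ = ⟪y, hm.toLp _⟫_ℝ := by
      have hr : (timeMeasure T).restrict (Ioo 0 τ) = volume.restrict (Ioo 0 τ) := by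
        rw [Measure.restrict_restrict measurableSet_Ioo, inter_eq_self_of_subset_left hsub]
      rw [L2.inner_def, ← hr, ← integral_indicator measurableSet_Ioo]
      refine integral_congr_ae ?_
      filter_upwards [hm.coeFn_toLp] with t ht
      rw [ht]
      by_cases h : t ∈ Ioo 0 τ <;> simp [h]
    rw [e1, hy, hβ]
    refine integral_nonneg_of_ae ?_
    filter_upwards [hm.coeFn_toLp] with t ht
    rw [ht]
    by_cases h : t ∈ Ioo 0 τ
    · simp [h, hpos]
    · simp [h]

end TimeDependentForm

/-! ### Multiplication forms on `L²` -/

section MultiplicationForm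

variable {X : Type*} [MeasurableSpace X] {ν : Measure X}

theorem integrable_bounded_mul_mul {q : X → ℝ} (hq : Measurable q) {M : ℝ} (hM : ∀ x, |q x| ≤ M)
    (h k : Lp ℝ 2 ν) : Integrable (fun x => q x * (h x * k x)) ν :=
  ((Lp.memLp h).integrable_mul (Lp.memLp k)).bdd_mul hq.aestronglyMeasurable
    (Eventually.of_forall hM)

/-- For bounded `q`, the form `∫ q h k` on `L²`. -/
theorem exists_mulForm {q : X → ℝ} (hq : Measurable q) {M : ℝ} (hM0 : 0 ≤ M)
    (hM : ∀ x, |q x| ≤ M) :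
    ∃ b : Lp ℝ 2 ν →L[ℝ] Lp ℝ 2 ν →L[ℝ] ℝ, (∀ h k, b h k = ∫ x, q x * (h x * k x) ∂ν) ∧
      ‖b‖ ≤ M := by
  have hint := integrable_bounded_mul_mul (ν := ν) hq hM
  let β₀ : Lp ℝ 2 ν →ₗ[ℝ] Lp ℝ 2 ν →ₗ[ℝ] ℝ :=
    LinearMap.mk₂ ℝ (fun h k => ∫ x, q x * (h x * k x) ∂ν)
      (fun h₁ h₂ k => by
        rw [← integral_add (hint _ _) (hint _ _)]
        refine integral_congr_ae ?_
        filter_upwards [Lp.coeFn_add h₁ h₂] with t ht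
        rw [ht, Pi.add_apply]
        ring)
      (fun c h k => by
        rw [smul_eq_mul, ← integral_const_mul]
        refine integral_congr_ae ?_
        filter_upwards [Lp.coeFn_smul c h] with t ht
        rw [ht, Pi.smul_apply, smul_eq_mul]
        ring)
      (fun h k₁ k₂ => by
        rw [← integral_add (hint _ _) (hint _ _)]
        refine integral_congr_ae ?_
        filter_upwards [Lp.coeFn_add k₁ k₂] with t ht
        rw [ht, Pi.add_apply]
        ring)
      (fun c h k => by
        rw [smul_eq_mul, ← integral_const_mul]
        refine integral_congr_ae ?_
        filter_upwards [Lp.coeFn_smul c k] with t ht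
        rw [ht, Pi.smul_apply, smul_eq_mul]
        ring)
  have hbound : ∀ h k, ‖β₀ h k‖ ≤ M * ‖h‖ * ‖k‖ := by
    intro h k
    have hprod : Integrable (fun x => ‖h x‖ * ‖k x‖) ν :=
      (Lp.memLp h).norm.integrable_mul (Lp.memLp k).norm
    calc ‖β₀ h k‖ ≤ ∫ x, M * (‖h x‖ * ‖k x‖) ∂ν := by
          refine norm_integral_le_of_norm_le (hprod.const_mul _) (Eventually.of_forall fun x => ?_)
          rw [norm_mul, norm_mul]
          gcongr
          exact hM x
      _ = M * ∫ x, ‖h x‖ * ‖k x‖ ∂ν := integral_const_mul _ _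
      _ ≤ M * (‖h‖ * ‖k‖) := by
          gcongr
          exact integral_norm_mul_norm_le h k
      _ = _ := by ring
  exact ⟨β₀.mkContinuous₂ M hbound, fun h k => rfl, β₀.mkContinuous₂_norm_le hM0 hbound⟩

end MultiplicationForm

/-! ### The potential `‖v‖ - v χ_ω` -/

section Potential

variable {N : ℕ} {T : ℝ} {ω : Set (Euc N)}

/-- Fubini gives the slicewise bound with `x` as the outer variable; the order is exchanged because
the forms are indexed by `t`. -/
theorem LInfCyl.ae_ae_abs_le (v : LInfCyl ω T) :
    ∀ᵐ t ∂(timeMeasure T), ∀ᵐ x ∂(volume.restrict ω), |v (x, t)| ≤ ‖v‖ := by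
  have h1 : ∀ᵐ p ∂((volume : Measure (Euc N × ℝ)).restrict (ω ×ˢ Ioo 0 T)), |v p| ≤ ‖v‖ := by
    have h2 := ae_le_eLpNormEssSup (f := v)
      (μ := (volume : Measure (Euc N × ℝ)).restrict (ω ×ˢ Ioo 0 T))
    filter_upwards [h2] with p hp
    rw [← eLpNorm_exponent_top] at hp
    rw [Lp.norm_def, ← Real.norm_eq_abs, ← toReal_enorm]
    exact ENNReal.toReal_mono (Lp.eLpNorm_ne_top v) hp
  have hm : (volume : Measure (Euc N × ℝ)).restrict (ω ×ˢ Ioo 0 T) =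
      (volume.restrict ω).prod (timeMeasure T) := by
    rw [Measure.volume_eq_prod, Measure.prod_restrict]
  have h1' : ∀ᵐ p ∂((volume.restrict ω).prod (timeMeasure T)), |v p| ≤ ‖v‖ := by
    rw [← hm]
    exact h1
  have h3 := Measure.ae_ae_of_ae_prod h1'
  refine (Measure.ae_ae_comm (p := fun x t => |v (x, t)| ≤ ‖v‖) ?_).1 h3
  exact measurableSet_le (Lp.stronglyMeasurable v).measurable.norm measurable_const

/-- The nonnegative potential `‖v‖ - v χ_ω`, with `v` truncated at `± ‖v‖`. -/
noncomputable def potential (ω : Set (Euc N)) (v : LInfCyl ω T) (t : ℝ) (x : Euc N) : ℝ :=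
  ‖v‖ - ω.indicator (fun x => max (-‖v‖) (min ‖v‖ (v (x, t)))) x

theorem potential_measurable (hω : MeasurableSet ω) (v : LInfCyl ω T) :
    Measurable (Function.uncurry (potential ω v)) := by
  have hv : Measurable fun p : ℝ × Euc N => max (-‖v‖) (min ‖v‖ (v (p.2, p.1))) :=
    measurable_const.max (measurable_const.min
      ((Lp.stronglyMeasurable v).measurable.comp measurable_swap))
  refine (measurable_const (a := ‖v‖)).sub ?_
  have h : (fun p : ℝ × Euc N => ω.indicator (fun x => max (-‖v‖) (min ‖v‖ (v (x, p.1)))) p.2) =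
      (Prod.snd ⁻¹' ω).indicator fun p : ℝ × Euc N => max (-‖v‖) (min ‖v‖ (v (p.2, p.1))) := by
    funext p
    by_cases hp : p.2 ∈ ω <;> simp [hp]
  change Measurable fun p : ℝ × Euc N => ω.indicator _ p.2
  rw [h]
  exact hv.indicator (measurable_snd hω)

/-- Thanks to the truncation this holds at every point, so the form is nonnegative for every `t` and
not just almost every one. -/
theorem potential_nonneg (v : LInfCyl ω T) (t : ℝ) (x : Euc N) : 0 ≤ potential ω v t x := by
  have h0 := norm_nonneg v
  rw [potential, sub_nonneg]
  by_cases hx : x ∈ ω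
  · rw [indicator_of_mem hx]
    exact max_le (by linarith) (min_le_left _ _)
  · rwa [indicator_of_notMem hx]

theorem potential_le (v : LInfCyl ω T) (t : ℝ) (x : Euc N) : potential ω v t x ≤ 2 * ‖v‖ := by
  have h0 := norm_nonneg v
  rw [potential]
  by_cases hx : x ∈ ω
  · rw [indicator_of_mem hx]
    linarith [le_max_left (-‖v‖) (min ‖v‖ (v (x, t)))]
  · rw [indicator_of_notMem hx]
    linarith

theorem abs_potential_le (v : LInfCyl ω T) (t : ℝ) (x : Euc N) :
    |potential ω v t x| ≤ 2 * ‖v‖ := by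
  rw [abs_of_nonneg (potential_nonneg v t x)]
  exact potential_le v t x

theorem integral_potential_mul {Ω : Set (Euc N)} (hω : MeasurableSet ω) (hωΩ : ω ⊆ Ω)
    (v : LInfCyl ω T) {t : ℝ} (ht : ∀ᵐ x ∂(volume.restrict ω), |v (x, t)| ≤ ‖v‖)
    (h k : Lp ℝ 2 (volume.restrict Ω)) :
    ∫ x in Ω, potential ω v t x * (h x * k x) =
      ‖v‖ * (∫ x in Ω, h x * k x) - ∫ x in ω, v (x, t) * (h x * k x) := by
  have hhk : IntegrableOn (fun x => h x * k x) Ω := (Lp.memLp h).integrable_mul (Lp.memLp k)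
  have hpm : Measurable (potential ω v t) :=
    (potential_measurable hω v).comp measurable_prodMk_left
  have h1 := integrable_bounded_mul_mul hpm (abs_potential_le v t) h k
  have h2 : ∫ x in ω, v (x, t) * (h x * k x) =
      ∫ x in Ω, (‖v‖ * (h x * k x) - potential ω v t x * (h x * k x)) := by
    have e : ∫ x in Ω, (‖v‖ * (h x * k x) - potential ω v t x * (h x * k x)) =
        ∫ x in Ω, ω.indicator (fun x => max (-‖v‖) (min ‖v‖ (v (x, t))) * (h x * k x)) x := by
      refine integral_congr_ae (Eventually.of_forall fun x => ?_)
      by_cases hx : x ∈ ω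
      · simp only [potential, indicator_of_mem hx]
        ring
      · simp only [potential, indicator_of_notMem hx]
        ring
    rw [e, integral_indicator hω, Measure.restrict_restrict hω, inter_eq_self_of_subset_left hωΩ]
    refine integral_congr_ae ?_
    filter_upwards [ht] with x hx
    rw [abs_le] at hx
    rw [min_eq_right hx.2, max_eq_right hx.1]
  rw [h2, integral_sub (hhk.const_mul _) h1, integral_const_mul]
  ring

/-- The form `∫_Ω (‖v‖ - v(t) χ_ω) h k` on `L²(Ω)`. -/
theorem exists_potentialForm {Ω : Set (Euc N)} (hω : MeasurableSet ω) (hωΩ : ω ⊆ Ω)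
    (v : LInfCyl ω T) :
    ∃ b : ℝ → Lp ℝ 2 (volume.restrict Ω) →L[ℝ] Lp ℝ 2 (volume.restrict Ω) →L[ℝ] ℝ,
      (∀ h k, StronglyMeasurable fun t => b t h k) ∧ (∀ t, ‖b t‖ ≤ 2 * ‖v‖) ∧
      (∀ t h, 0 ≤ b t h h) ∧
      ∀ᵐ t ∂(timeMeasure T), ∀ h k : Lp ℝ 2 (volume.restrict Ω),
        b t h k = ‖v‖ * (∫ x in Ω, h x * k x) - ∫ x in ω, v (x, t) * (h x * k x) := by
  have hpm : ∀ t, Measurable (potential ω v t) := fun t =>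
    (potential_measurable hω v).comp measurable_prodMk_left
  choose b hb hbn using fun t => exists_mulForm (ν := volume.restrict Ω) (hpm t)
    (by positivity : 0 ≤ 2 * ‖v‖) (abs_potential_le v t)
  refine ⟨b, fun h k => ?_, hbn, fun t h => ?_, ?_⟩
  · simp only [hb]
    have hm : StronglyMeasurable fun p : ℝ × Euc N => potential ω v p.1 p.2 * (h p.2 * k p.2) :=
      (potential_measurable hω v).stronglyMeasurable.mul
        (((Lp.stronglyMeasurable h).comp_measurable measurable_snd).mul
          ((Lp.stronglyMeasurable k).comp_measurable measurable_snd))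
    exact hm.integral_prod_right
  · rw [hb]
    exact integral_nonneg fun x => mul_nonneg (potential_nonneg v t x) (mul_self_nonneg _)
  · filter_upwards [LInfCyl.ae_ae_abs_le v] with t ht h k
    rw [hb]
    exact integral_potential_mul hω hωΩ v ht h k

end Potential

/-! ### Riesz representation in Bochner spaces -/

section Duality

variable {V : Type*} [NormedAddCommGroup V] [InnerProductSpace ℝ V] {T : ℝ}

theorem exists_lp_dual (G : Lp V 2 (timeMeasure T)) :
    ∃ g : Lp (StrongDual ℝ V) 2 (timeMeasure T),
      (∀ᵐ t ∂(timeMeasure T), ∀ w, ⟪G t, w⟫_ℝ = g t w) ∧ ‖g‖ ≤ ‖G‖ := by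
  have h := (innerBilin V).coeFn_compLpL (p := 2) G
  refine ⟨(innerBilin V).compLpL 2 (timeMeasure T) G, ?_, ?_⟩
  · filter_upwards [h] with t ht w
    rw [ht, innerBilin_apply]
  · refine Lp.norm_le_norm_of_ae_le ?_
    filter_upwards [h] with t ht
    rw [ht]
    refine ContinuousLinearMap.opNorm_le_bound _ (norm_nonneg _) fun w => ?_
    rw [innerBilin_apply]
    exact norm_inner_le_norm _ _

/-- The weight `a` is `e^{-rt}` for the right-hand side and 1 for the derivatives of test functions.
-/
theorem exists_lp_riesz [CompleteSpace V] (g : Lp (StrongDual ℝ V) 2 (timeMeasure T)) {a : ℝ → ℝ}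
    (ha : Continuous a) (ha1 : ∀ t ∈ Ioo 0 T, |a t| ≤ 1) :
    ∃ F : Lp V 2 (timeMeasure T),
      (∀ᵐ t ∂(timeMeasure T), ∀ w, ⟪F t, w⟫_ℝ = a t * g t w) ∧ ‖F‖ ≤ ‖g‖ := by
  have hle : ∀ᵐ t ∂(timeMeasure T),
      ‖a t • (InnerProductSpace.toDual ℝ V).symm (g t)‖ ≤ ‖g t‖ := by
    filter_upwards [ae_restrict_mem measurableSet_Ioo] with t ht
    rw [norm_smul, LinearIsometryEquiv.norm_map, Real.norm_eq_abs]
    exact mul_le_of_le_one_left (norm_nonneg _) (ha1 t ht)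
  have hm : MemLp (fun t => a t • (InnerProductSpace.toDual ℝ V).symm (g t)) 2 (timeMeasure T) :=
    (Lp.memLp g).of_le (ha.aestronglyMeasurable.smul
      ((InnerProductSpace.toDual ℝ V).symm.continuous.comp_aestronglyMeasurable
        (Lp.aestronglyMeasurable g))) hle
  refine ⟨hm.toLp _, ?_, Lp.norm_le_norm_of_ae_le ?_⟩
  · filter_upwards [hm.coeFn_toLp] with t ht w
    rw [ht, real_inner_smul_left, InnerProductSpace.toDual_symm_apply]
  · filter_upwards [hm.coeFn_toLp, hle] with t h1 h2
    rwa [h1]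

end Duality

/-! ### From the concrete weak formulation to the abstract one -/

section Translation

theorem integral_inner_lp {N : ℕ} {Ω : Set (Euc N)} (h k : Lp ℝ 2 (volume.restrict Ω)) :
    ∫ x in Ω, h x * k x = ⟪h, k⟫_ℝ := by
  rw [L2.inner_def]
  refine integral_congr_ae (Eventually.of_forall fun x => ?_)
  simp only [RCLike.inner_apply, conj_trivial, mul_comm]

variable {N : ℕ} [NeZero N] {s : Ioo (0 : ℝ) 1} {Ω : Set (Euc N)} {T : ℝ}

theorem isTimeDeriv_iff {j : HZero s Ω →L[ℝ] Lp ℝ 2 (volume.restrict Ω)}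
    (hj : ∀ u, j u = u.toL2) {z G : L2V s Ω T} {g : L2VDual s Ω T}
    (h : ∀ᵐ t ∂(timeMeasure T), ∀ w, ⟪G t, w⟫_ℝ = g t w) :
    IsTimeDeriv z g ↔ HasWeakDeriv j z G := by
  have h1 : ∀ (ψ : ℝ → ℝ) (w : HZero s Ω),
      ∫ t in Ioo 0 T, deriv ψ t * ∫ x in Ω, (z t).fn x * w.fn x =
        ∫ t in Ioo 0 T, deriv ψ t * ⟪j (z t), j w⟫_ℝ := fun ψ w => by
    simp only [hj, HZero.integral_mul_eq_inner]
  have h2 : ∀ (ψ : ℝ → ℝ) (w : HZero s Ω),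
      ∫ t in Ioo 0 T, ψ t * g t w = ∫ t in Ioo 0 T, ψ t * ⟪G t, w⟫_ℝ := fun ψ w => by
    refine integral_congr_ae ?_
    filter_upwards [h] with t ht
    rw [ht]
  simp only [IsTimeDeriv, HasWeakDeriv, h1, h2]

theorem isContRep_iff {j : HZero s Ω →L[ℝ] Lp ℝ 2 (volume.restrict Ω)}
    (hj : ∀ u, j u = u.toL2) {z : L2V s Ω T} {y : ℝ → Lp ℝ 2 (volume.restrict Ω)} :
    IsContRep z y ↔ IsRep j z y := by
  simp only [IsContRep, IsRep, hj]

/-- The terms in `r` and `v` combine into `⟪B z, φ⟫`, and by Riesz the derivatives `φ_t` correspond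
to representatives `Φ`, so both formulations have the same test functions. -/
theorem isWeakSolution_iff [CompleteSpace (HZero s Ω)]
    {j : HZero s Ω →L[ℝ] Lp ℝ 2 (volume.restrict Ω)} (hj : ∀ u, j u = u.toL2)
    {ω : Set (Euc N)} (hωΩ : ω ⊆ Ω) {v : LInfCyl ω T} {r : ℝ}
    {b : ℝ → Lp ℝ 2 (volume.restrict Ω) →L[ℝ] Lp ℝ 2 (volume.restrict Ω) →L[ℝ] ℝ}
    (hbi : ∀ z φ : L2V s Ω T, Integrable (fun t => b t (j (z t)) (j (φ t))) (timeMeasure T))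
    (hb : ∀ᵐ t ∂(timeMeasure T), ∀ h k : Lp ℝ 2 (volume.restrict Ω),
      b t h k = r * (∫ x in Ω, h x * k x) - ∫ x in ω, v (x, t) * (h x * k x))
    {B : L2V s Ω T →L[ℝ] L2V s Ω T}
    (hB : ∀ z φ, ⟪B z, φ⟫_ℝ = ∫ t in Ioo 0 T, b t (j (z t)) (j (φ t)))
    {f : L2VDual s Ω T} {F : L2V s Ω T}
    (hF : ∀ᵐ t ∂(timeMeasure T), ∀ w, ⟪F t, w⟫_ℝ = Real.exp (-r * t) * f t w)
    {ρ : Lp ℝ 2 (volume.restrict Ω)} {z : L2V s Ω T} :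
    IsWeakSolution ω r f v ρ z ↔ IsWeakSol j B F ρ z := by
  have e1 : ∀ φ : L2V s Ω T,
      ∫ t in Ioo 0 T, fracForm (s : ℝ) (z t).fn (φ t).fn = ⟪z, φ⟫_ℝ := fun φ => by
    rw [L2.inner_def]
    rfl
  have e2 : ∀ φ : L2V s Ω T, r * (∫ t in Ioo 0 T, ∫ x in Ω, (z t).fn x * (φ t).fn x) -
      (∫ t in Ioo 0 T, ∫ x in ω, v (x, t) * (z t).fn x * (φ t).fn x) = ⟪B z, φ⟫_ℝ := fun φ => by
    have hin : Integrable (fun t => ⟪j (z t), j (φ t)⟫_ℝ) (timeMeasure T) := by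
      refine (L2.integrable_inner (𝕜 := ℝ) (j.compLpL 2 (timeMeasure T) z)
        (j.compLpL 2 (timeMeasure T) φ)).congr ?_
      filter_upwards [j.coeFn_compLpL (p := 2) z, j.coeFn_compLpL (p := 2) φ] with t a c
      rw [a, c]
    have h2 : ∫ t in Ioo 0 T, ∫ x in ω, v (x, t) * (z t).fn x * (φ t).fn x =
        ∫ t in Ioo 0 T, (r * ⟪j (z t), j (φ t)⟫_ℝ - b t (j (z t)) (j (φ t))) := by
      refine integral_congr_ae ?_
      filter_upwards [hb] with t ht
      rw [ht, integral_inner_lp, sub_sub_cancel]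
      refine integral_congr_ae ?_
      filter_upwards [ae_restrict_of_ae_restrict_of_subset hωΩ (z t).toL2_coeFn,
        ae_restrict_of_ae_restrict_of_subset hωΩ (φ t).toL2_coeFn] with x a c
      rw [hj, hj, a, c, mul_assoc]
    simp only [HZero.integral_mul_eq_inner, ← hj]
    rw [h2, integral_sub (hin.const_mul r) (hbi z φ), integral_const_mul, hB]
    ring
  have e3 : ∀ φ : L2V s Ω T, ∫ t in Ioo 0 T, Real.exp (-r * t) * f t (φ t) = ⟪F, φ⟫_ℝ :=
      fun φ => by
    rw [L2.inner_def]
    refine integral_congr_ae ?_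
    filter_upwards [hF] with t ht
    rw [ht]
  have e4 : ∀ (Φ : L2V s Ω T) (φt : L2VDual s Ω T),
      (∀ᵐ t ∂(timeMeasure T), ∀ w, ⟪Φ t, w⟫_ℝ = φt t w) →
      ∫ t in Ioo 0 T, φt t (z t) = ⟪Φ, z⟫_ℝ := fun Φ φt h => by
    rw [L2.inner_def]
    refine integral_congr_ae ?_
    filter_upwards [h] with t ht
    rw [ht]
  constructor
  · intro h φ Φ y h1 h2 h3
    obtain ⟨φt, hφt, -⟩ := exists_lp_dual Φ
    have h4 := h φ φt y ((isTimeDeriv_iff hj hφt).2 h1) ((isContRep_iff hj).2 h2) h3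
    rw [e4 Φ φt hφt, e1, e3, integral_inner_lp, add_sub_assoc, e2] at h4
    exact h4
  · intro h φ φt y h1 h2 h3
    obtain ⟨Φ, hΦ, -⟩ := exists_lp_riesz φt (a := fun _ => 1) continuous_const (by simp)
    simp only [one_mul] at hΦ
    have h4 := h φ Φ y ((isTimeDeriv_iff hj hΦ).1 h1) ((isContRep_iff hj).1 h2) h3
    rw [e4 Φ φt hΦ, e1, e3, integral_inner_lp, add_sub_assoc, e2]
    exact h4

end Translation

/-! ### The main theorem -/

theorem theorem3p2 (N : ℕ) [NeZero N] (s : Set.Ioo (0 : ℝ) 1) (Ω : Set (Euc N))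
    (hΩ_open : IsOpen Ω) (hΩ_conn : IsConnected Ω) (hΩ_bdd : Bornology.IsBounded Ω) :
    ∃ C : ℝ, 0 < C ∧
      ∀ (T : ℝ), 0 < T → ∀ (ω : Set (Euc N)), IsOpen ω → ω ⊆ Ω →
      ∀ (f : L2VDual s Ω T) (v : LInfCyl ω T) (ρ₀ : Lp ℝ 2 (volume.restrict Ω)),
        ∃ z : L2V s Ω T,
          IsWeakSolution ω ‖v‖ f v ρ₀ z ∧
          (∀ z' : L2V s Ω T, IsWeakSolution ω ‖v‖ f v ρ₀ z' → z' = z) ∧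
          (∃ zc : ℝ → Lp ℝ 2 (volume.restrict Ω), IsContRep z zc ∧
            ∀ τ ∈ Set.Icc 0 T, ‖zc τ‖ ^ 2 ≤ ‖f‖ ^ 2 + ‖ρ₀‖ ^ 2) ∧
          ‖z‖ ^ 2 ≤ ‖f‖ ^ 2 + ‖ρ₀‖ ^ 2 ∧
          (∃ zt : L2VDual s Ω T, IsTimeDeriv z zt ∧
            wNorm z zt ≤ (C * ‖v‖ + 3) * (‖f‖ + ‖ρ₀‖)) := by
  have : CompleteSpace (HZero s Ω) := HZero.completeSpace hΩ_bdd
  -- Used to infer the separability of `L²(Ω)`.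
  have : Fact ((2 : ℝ≥0∞) ≠ ∞) := ⟨by norm_num⟩
  obtain ⟨j, hj⟩ := HZero.exists_embedding (s := s) hΩ_bdd
  have hinj : Function.Injective j := fun u w h =>
    HZero.toL2_injective hΩ_open.measurableSet (by rwa [hj, hj] at h)
  -- `2 ‖v‖ ‖j‖²` bounds the norm of `B`; the summand 1 only makes the constant positive. The
  -- embedding `j` is fixed before `T`, `ω` and the data.
  refine ⟨2 * ‖j‖ ^ 2 + 1, by positivity, fun T hT ω hω hωΩ f v ρ₀ => ?_⟩
  have hr : 0 ≤ ‖v‖ := norm_nonneg v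
  obtain ⟨b, hbm, hbn, hbp, hb⟩ := exists_potentialForm hω.measurableSet hωΩ v
  obtain ⟨B, hB, hBn, hBp⟩ := exists_timeForm_operator (T := T) j hbm hbn hbp
  obtain ⟨F, hF, hFn⟩ := exists_lp_riesz f (a := fun t => Real.exp (-‖v‖ * t)) (by fun_prop)
    (fun t ht => by
      rw [abs_of_pos (Real.exp_pos _), Real.exp_le_one_iff]
      have := mul_nonneg hr ht.1.le
      linarith)
  have hiff : ∀ z, IsWeakSolution ω ‖v‖ f v ρ₀ z ↔ IsWeakSol j B F ρ₀ z := fun z =>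
    isWeakSolution_iff hj hωΩ (integrable_timeForm j hbm hbn) hb hB hF
  have hB0 : ∀ z, 0 ≤ ⟪B z, z⟫_ℝ := fun z => by
    rw [L2.inner_def]
    exact hBp z T hT.le le_rfl
  obtain ⟨z, hz⟩ := exists_isWeakSol hinj hT hB0 F ρ₀
  obtain ⟨⟨y, hy, hyle⟩, hzle⟩ := hz.estimates hinj hT hBp
  have hF2 : ‖F‖ ^ 2 ≤ ‖f‖ ^ 2 := pow_le_pow_left₀ (norm_nonneg _) hFn 2
  obtain ⟨zt, hzt, hztn⟩ := exists_lp_dual (F - z - B z)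
  refine ⟨z, (hiff z).2 hz, fun z' hz' => hz.eq hinj hT hBp ((hiff z').1 hz'),
    ⟨y, (isContRep_iff hj).2 hy, fun τ hτ => (hyle τ hτ).trans (by linarith)⟩, by linarith,
    zt, (isTimeDeriv_iff hj hzt).2 (hz.hasWeakDeriv), ?_⟩
  have hf0 := norm_nonneg f
  have hρ0 := norm_nonneg ρ₀
  have hz1 : ‖z‖ ≤ ‖f‖ + ‖ρ₀‖ := by
    refine abs_le_of_sq_le_sq' ?_ (by positivity) |>.2
    nlinarith
  have hzt1 : ‖zt‖ ≤ ‖f‖ + ‖z‖ + 2 * ‖v‖ * ‖j‖ ^ 2 * ‖z‖ := by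
    refine hztn.trans ((norm_sub_le _ _).trans (add_le_add ((norm_sub_le _ _).trans ?_) (hBn z)))
    gcongr
  have hw : wNorm z zt ≤ ‖z‖ + ‖zt‖ := by
    rw [wNorm]
    refine Real.sqrt_le_iff.2 ⟨by positivity, ?_⟩
    nlinarith [norm_nonneg z, norm_nonneg zt]
  -- The 3 counts one `‖f‖` and two `‖z‖`: the norm of `z` itself and its occurrence in `z_t = F - z
  -- - B z`.
  calc wNorm z zt ≤ ‖f‖ + 2 * ‖z‖ + 2 * ‖v‖ * ‖j‖ ^ 2 * ‖z‖ := by linarith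
    _ ≤ (‖f‖ + ‖ρ₀‖) + 2 * (‖f‖ + ‖ρ₀‖) + 2 * ‖v‖ * ‖j‖ ^ 2 * (‖f‖ + ‖ρ₀‖) := by
      gcongr
      linarith
    _ ≤ ((2 * ‖j‖ ^ 2 + 1) * ‖v‖ + 3) * (‖f‖ + ‖ρ₀‖) := by
      nlinarith [mul_nonneg hr (add_nonneg hf0 hρ0)]
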